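/- Let $\Lambda\subset(-\infty,0]$ and $\Gamma\subset(0,\infty)$ be uniformly discrete sets (a set $S\subset\mathbb R$ is uniformly discrete if $\inf_{x,y\in S,\,x\ne y}|x-y|>0$), and assume $\sum_{\gamma\in\Gamma}\gamma^{-1/2}<\infty$. Let $(a_\lambda)_{\lambda\in\Lambda}$ and $(b_\gamma)_{\gamma\in\Gamma}$ be complex $\ell^2$ families. Then the series $$H(t)=\sum_{\lambda\in\Lambda}a_\lambda e^{2\pi i\lambda t}+\sum_{\gamma\in\Gamma}b_\gamma e^{2\pi i\gamma t}$$ converges unconditionally in $L^2(I)$ for every bounded interval $I\subset\mathbb R$ and so defines a function $H$ on $\mathbb R$ (up to null sets). If $H$ is nontrivial, then $H\notin L^2(\mathbb T,1/w)$ for every weight $w$ that is positive, increasing (not necessarily strictly) and bounded on $(0,1)$ and satisfies $\int_0^1\log w(t)\,dt=-\infty$. That is: if $\int_0^1|H(t)|^2\frac{1}{w(t)}\,dt<\infty$ for some such $w$, then $H=0$ almost everywhere on $\mathbb R$ and all the coefficients $a_\lambda$, $b_\gamma$ are zero. -/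

import Mathlib

open MeasureTheory Set Filter Topology
open scoped ENNReal

/-- A set of reals is uniformly discrete if distinct points have distance bounded below by a
positive constant (the empty set and one-point sets qualify: the infimum over no pairs is `+∞`). -/
def UniformlyDiscrete (S : Set ℝ) : Prop :=
  ∃ δ : ℝ, 0 < δ ∧ ∀ x ∈ S, ∀ y ∈ S, x ≠ y → δ ≤ |x - y|

/-- The exponential `t ↦ e^{2πiαt}`. -/
noncomputable def expo (α t : ℝ) : ℂ :=
  Complex.exp (2 * Real.pi * Complex.I * α * t)

/-- The partial sum of `∑ a_λ e^{2πiλt} + ∑ b_γ e^{2πiγt}` over the finite sets of frequencies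
`p.1 ⊆ L` and `p.2 ⊆ G`. -/
noncomputable def partialSum {L G : Set ℝ} (a : L → ℂ) (b : G → ℂ)
    (p : Finset L × Finset G) (t : ℝ) : ℂ :=
  (∑ l ∈ p.1, a l * expo l t) + ∑ g ∈ p.2, b g * expo g t

/-- `H = ∑_{λ ∈ L} a_λ e^{2πiλt} + ∑_{γ ∈ G} b_γ e^{2πiγt}`: `H` is measurable and the
finite partial sums converge to `H` (unconditionally) in `L²` on every bounded interval. -/
def IsNonharmonicSeries {L G : Set ℝ} (a : L → ℂ) (b : G → ℂ) (H : ℝ → ℂ) : Prop :=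
  AEStronglyMeasurable H volume ∧
  ∀ R : ℝ, Tendsto
    (fun p : Finset L × Finset G =>
      eLpNorm (fun t => H t - partialSum a b p t) 2 (volume.restrict (Icc (-R) R)))
    atTop (𝓝 0)

/-- The class of weights with a deep right-hand zero at the origin: `w` is positive,
(weakly) increasing and bounded on `(0,1)`, and `∫₀¹ log w = -∞`. As `log w` is bounded above on
`(0,1)`, the last condition says that the negative part of `log w` has infinite integral. -/
structure DeepZeroWeight (w : ℝ → ℝ) : Prop where
  pos : ∀ t ∈ Ioo (0 : ℝ) 1, 0 < w t
  mono : MonotoneOn w (Ioo 0 1)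
  bdd : BddAbove (w '' Ioo 0 1)
  log_integral : ∫⁻ t in Ioo (0 : ℝ) 1, ENNReal.ofReal (-Real.log (w t)) = ∞

/-- `H ∈ L²(𝕋, 1/w)`, that is `∫₀¹ |H|² / w < ∞`. -/
def MemWeightedL2 (w : ℝ → ℝ) (H : ℝ → ℂ) : Prop :=
  ∫⁻ t in Ioo (0 : ℝ) 1, ENNReal.ofReal (‖H t‖ ^ 2 / w t) < ∞

/-!
It suffices to show that the coefficient at the frequency `0` vanishes, as `H` may be multiplied
by any `e^{-2πiνt}`. Test `H` against `T = ∏ (1 - (i / 2πγ) d/dz) (F(z) / (z² + Y²))`, where `F`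
is bounded and holomorphic in the lower half-plane. Integrating by parts, the operator annihilates
the positive frequencies, and Poisson's formula evaluates a frequency `μ ≤ 0` at `-iY`, with a
factor `e^{2πμY}`. Thus `∫ H T` is about `(π / Y) F(-iY)` times the coefficient at `0` for a large
fixed `Y`.

Take `F = e^Φ ∏ (z / (z - iδ_γ))^10`, where `Φ` is a sum of bumps of total mass `W` with
`e^{2 re Φ}` controlled by `1 / w` on `(0, 1)` and by `1` elsewhere. By Cauchy's estimates the
operator enlarges `F` at `x` at most by a power of `∏ (1 + c_γ A / x²)`, `c_γ = 1 / (2πγ)`, with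
`A = 60 W`. The zeros of the product, with `δ_γ² = A c_γ`, compensate exactly for this, so that
`∫ |H T|` is bounded independently of `W` by `∫₀¹ |H|² / w` and the `L²` norm of `H`. They cost
`F(-iY)` only a factor `e^{-O(√A)}`, since `∑ √c_γ` is finite, whereas `e^{re Φ(-iY)}` is at least
`e^{W / 4Y}`. As `∫₀¹ log w = -∞` allows `W → ∞`, the coefficient is zero.
-/

/-! ### The differential operator -/

/-- The differential operator `∏ (1 - i c d/dz)` over the list of parameters `c`. With
`c = 1 / (2πγ)` it is the transpose of the operator that annihilates `e^{2πiγt}`. -/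
noncomputable def diffProd : List ℝ → (ℂ → ℂ) → ℂ → ℂ
  | [], f => f
  | c :: l, f => fun z => diffProd l f z - Complex.I * c * deriv (diffProd l f) z

theorem analyticAt_diffProd {f : ℂ → ℂ} {z : ℂ} (hf : AnalyticAt ℂ f z) (l : List ℝ) :
    AnalyticAt ℂ (diffProd l f) z := by
  induction l with
  | nil => exact hf
  | cons c l ih => exact ih.sub (analyticAt_const.mul ih.deriv)

theorem norm_iteratedDeriv_diffProd_cons_le {f : ℂ → ℂ} {z : ℂ} (hf : AnalyticAt ℂ f z) {c : ℝ}
    (hc : 0 ≤ c) (l : List ℝ) (k : ℕ) :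
    ‖iteratedDeriv k (diffProd (c :: l) f) z‖
      ≤ ‖iteratedDeriv k (diffProd l f) z‖ + c * ‖iteratedDeriv (k + 1) (diffProd l f) z‖ := by
  have ha := analyticAt_diffProd hf l
  have hsub : iteratedDeriv k (diffProd (c :: l) f) z = iteratedDeriv k (diffProd l f) z
      - Complex.I * c * iteratedDeriv (k + 1) (diffProd l f) z := by
    rw [iteratedDeriv_succ', ← iteratedDeriv_const_mul_field, ← iteratedDeriv_fun_sub]
    · rfl
    · exact ha.contDiffAt
    · exact (analyticAt_const.mul ha.deriv).contDiffAt
  rw [hsub]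
  refine (norm_sub_le _ _).trans_eq ?_
  rw [norm_mul, norm_mul, Complex.norm_I, one_mul, Complex.norm_of_nonneg hc]

/-- The factor `∏ (1 + c R)` by which `diffProd l` can enlarge a function varying at rate `R`. -/
noncomputable def growthFactor (R : ℝ) (l : List ℝ) : ℝ :=
  (l.map fun c => 1 + c * R).prod

/-- The radius `∑ c / (1 + c R)` of holomorphy that `diffProd l` consumes for the growth
`growthFactor R l`; it is the logarithmic derivative of `growthFactor · l` at `R`. -/
noncomputable def growthRadius (R : ℝ) (l : List ℝ) : ℝ :=
  (l.map fun c => c / (1 + c * R)).sum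

theorem growthFactor_nonneg {R : ℝ} (hR : 0 ≤ R) {l : List ℝ} (hl : ∀ c ∈ l, 0 ≤ c) :
    0 ≤ growthFactor R l :=
  List.prod_nonneg <| by
    simp only [List.mem_map, forall_exists_index, and_imp, forall_apply_eq_imp_iff₂]
    intro c hc
    have := hl c hc
    positivity

theorem growthRadius_nonneg {R : ℝ} (hR : 0 ≤ R) {l : List ℝ} (hl : ∀ c ∈ l, 0 ≤ c) :
    0 ≤ growthRadius R l :=
  List.sum_nonneg <| by
    simp only [List.mem_map, forall_exists_index, and_imp, forall_apply_eq_imp_iff₂]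
    intro c hc
    have := hl c hc
    positivity

theorem factorial_div_pow_add_le {c R r : ℝ} (hc : 0 ≤ c) (hR : 0 ≤ R) (hr : c / (1 + c * R) < r)
    (k : ℕ) :
    k.factorial / r ^ (k + 1) + c * ((k + 1).factorial / r ^ (k + 1 + 1))
      ≤ (1 + c * R) * (k.factorial / (r - c / (1 + c * R)) ^ (k + 1)) := by
  have : 0 < 1 + c * R := by positivity
  obtain ⟨d, hd⟩ : ∃ d, d = c / (1 + c * R) := ⟨_, rfl⟩
  have hd0 : 0 ≤ d := by rw [hd]; positivity
  have hcd : c = d * (1 + c * R) := by rw [hd]; field_simp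
  rw [← hd] at hr ⊢
  have hr0 : 0 < r := hd0.trans_lt hr
  have hrd : 0 < r - d := sub_pos.2 hr
  have bernoulli : 1 + (k + 1 : ℕ) * (d / r) ≤ (r / (r - d)) ^ (k + 1) :=
    calc 1 + (k + 1 : ℕ) * (d / r) ≤ 1 + (k + 1 : ℕ) * (d / (r - d)) := by gcongr; linarith
      _ ≤ (1 + d / (r - d)) ^ (k + 1) :=
        one_add_mul_le_pow (le_trans (by norm_num) (div_nonneg hd0 hrd.le)) _
      _ = (r / (r - d)) ^ (k + 1) := by congr 1; field_simp; ring
  calc k.factorial / r ^ (k + 1) + c * ((k + 1).factorial / r ^ (k + 1 + 1))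
      = k.factorial / r ^ (k + 1) * (1 + (1 + c * R) * ((k + 1 : ℕ) * (d / r))) := by
        conv_lhs => rw [hcd]
        rw [Nat.factorial_succ]; push_cast; field_simp; ring
    _ ≤ k.factorial / r ^ (k + 1) * ((1 + c * R) * (1 + (k + 1 : ℕ) * (d / r))) := by
        gcongr
        rw [mul_one_add]
        gcongr
        exact le_add_of_nonneg_right (mul_nonneg hc hR)
    _ ≤ k.factorial / r ^ (k + 1) * ((1 + c * R) * (r / (r - d)) ^ (k + 1)) := by gcongr
    _ = (1 + c * R) * (k.factorial / (r - d) ^ (k + 1)) := by rw [div_pow]; field_simp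

theorem norm_iteratedDeriv_diffProd_le {f : ℂ → ℂ} {z : ℂ} (hf : AnalyticAt ℂ f z) {B r R : ℝ}
    (hB : 0 ≤ B) (hR : 0 ≤ R)
    (hb : ∀ k : ℕ, ‖iteratedDeriv k f z‖ ≤ B * (k.factorial / r ^ (k + 1))) {l : List ℝ}
    (hl : ∀ c ∈ l, 0 ≤ c) (hr : growthRadius R l < r) (k : ℕ) :
    ‖iteratedDeriv k (diffProd l f) z‖
      ≤ B * growthFactor R l * (k.factorial / (r - growthRadius R l) ^ (k + 1)) := by
  induction l generalizing k with
  | nil => simpa [diffProd, growthFactor, growthRadius] using hb k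
  | cons c l ih =>
    obtain ⟨hc, hl⟩ := List.forall_mem_cons.1 hl
    have hcons : growthRadius R (c :: l) = c / (1 + c * R) + growthRadius R l := rfl
    rw [hcons] at hr ⊢
    have ih := ih hl (by linarith [show 0 ≤ c / (1 + c * R) by positivity])
    have hP : 0 ≤ growthFactor R l := growthFactor_nonneg hR hl
    calc _ ≤ _ := norm_iteratedDeriv_diffProd_cons_le hf hc l k
      _ ≤ _ := add_le_add (ih k) (mul_le_mul_of_nonneg_left (ih (k + 1)) hc)
      _ = B * growthFactor R l * (k.factorial / (r - growthRadius R l) ^ (k + 1)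
            + c * ((k + 1).factorial / (r - growthRadius R l) ^ (k + 1 + 1))) := by ring
      _ ≤ B * growthFactor R l * ((1 + c * R) *
            (k.factorial / (r - growthRadius R l - c / (1 + c * R)) ^ (k + 1))) := by
          gcongr
          exact factorial_div_pow_add_le hc hR (by linarith) k
      _ = B * growthFactor R (c :: l) *
            (k.factorial / (r - (c / (1 + c * R) + growthRadius R l)) ^ (k + 1)) := by
          rw [growthFactor, growthFactor, List.map_cons, List.prod_cons, sub_sub, add_comm]
          ring

theorem norm_diffProd_le {f : ℂ → ℂ} {z : ℂ} {M R : ℝ} (hR : 0 ≤ R) {l : List ℝ}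
    (hl : ∀ c ∈ l, 0 < c)
    (hf : ∀ ζ ∈ Metric.closedBall z (2 * growthRadius R l), AnalyticAt ℂ f ζ)
    (hM : ∀ ζ ∈ Metric.closedBall z (2 * growthRadius R l), ‖f ζ‖ ≤ M) :
    ‖diffProd l f z‖ ≤ 2 * M * growthFactor R l := by
  have hl' : ∀ c ∈ l, 0 ≤ c := fun c hc => (hl c hc).le
  have hz : z ∈ Metric.closedBall z (2 * growthRadius R l) :=
    Metric.mem_closedBall_self (mul_nonneg zero_le_two (growthRadius_nonneg hR hl'))
  have hM0 : 0 ≤ M := (norm_nonneg _).trans (hM z hz)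
  rcases eq_or_ne l [] with rfl | hne
  · simpa [diffProd, growthFactor] using (hM z hz).trans (le_mul_of_one_le_left hM0 one_le_two)
  have hT : 0 < growthRadius R l := by
    refine List.sum_pos _ ?_ (by simpa using hne)
    simp only [List.mem_map, forall_exists_index, and_imp, forall_apply_eq_imp_iff₂]
    intro c hc
    have := hl c hc
    positivity
  have cauchy : ∀ k : ℕ, ‖iteratedDeriv k f z‖ ≤
      M * (2 * growthRadius R l) * (k.factorial / (2 * growthRadius R l) ^ (k + 1)) := fun k => by
    refine (Complex.norm_iteratedDeriv_le_of_forall_mem_sphere_norm_le (n := k) (C := M)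
      (mul_pos two_pos hT) (DifferentiableOn.diffContOnCl_ball
        (fun ζ hζ => (hf ζ hζ).differentiableAt.differentiableWithinAt) le_rfl)
      fun ζ hζ => hM ζ (Metric.sphere_subset_closedBall hζ)).trans_eq ?_
    field_simp
    ring
  have h := norm_iteratedDeriv_diffProd_le (hf z hz) (by positivity) hR cauchy hl' (by linarith) 0
  rw [iteratedDeriv_zero] at h
  refine h.trans_eq ?_
  rw [two_mul, add_sub_cancel_right, zero_add, pow_one, Nat.factorial_zero, Nat.cast_one]
  field_simp
  ring

/-- `f` is holomorphic and `O(1 / (1 + (Re z)²))` on some strip around the real axis. -/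
def StripDecay (f : ℂ → ℂ) : Prop :=
  ∃ η > 0, DifferentiableOn ℂ f {z | |z.im| < η} ∧
    ∃ K : ℝ, ∀ z : ℂ, |z.im| < η → ‖f z‖ ≤ K / (1 + z.re ^ 2)

theorem isOpen_strip (η : ℝ) : IsOpen {z : ℂ | |z.im| < η} :=
  isOpen_lt (by fun_prop) continuous_const

namespace StripDecay

variable {f g : ℂ → ℂ}

theorem differentiableAt_ofReal (h : StripDecay f) (x : ℝ) : DifferentiableAt ℂ f x := by
  obtain ⟨η, hη, hd, -⟩ := h
  exact hd.differentiableAt ((isOpen_strip η).mem_nhds (by simpa using hη))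

theorem continuous_ofReal (h : StripDecay f) : Continuous fun x : ℝ => f x :=
  continuous_iff_continuousAt.2 fun x =>
    (h.differentiableAt_ofReal x).continuousAt.comp Complex.continuous_ofReal.continuousAt

theorem integrable_ofReal (h : StripDecay f) : Integrable fun x : ℝ => f x := by
  obtain ⟨η, hη, -, K, hK⟩ := id h
  refine (integrable_inv_one_add_sq.const_mul K).mono' h.continuous_ofReal.aestronglyMeasurable
    (Eventually.of_forall fun x => ?_)
  simpa [div_eq_mul_inv] using hK x (by simpa using hη)

theorem sub (hf : StripDecay f) (hg : StripDecay g) : StripDecay fun z => f z - g z := by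
  obtain ⟨η, hη, hfd, K, hK⟩ := hf
  obtain ⟨θ, hθ, hgd, J, hJ⟩ := hg
  refine ⟨min η θ, lt_min hη hθ, ?_, K + J, fun z hz => ?_⟩
  · exact (hfd.mono fun z (hz : |z.im| < min η θ) => (lt_min_iff.1 hz).1).sub
      (hgd.mono fun z (hz : |z.im| < min η θ) => (lt_min_iff.1 hz).2)
  · rw [add_div]
    exact (norm_sub_le _ _).trans (add_le_add (hK z (lt_min_iff.1 hz).1) (hJ z (lt_min_iff.1 hz).2))

theorem const_mul (hf : StripDecay f) (c : ℂ) : StripDecay fun z => c * f z := by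
  obtain ⟨η, hη, hd, K, hK⟩ := hf
  refine ⟨η, hη, hd.const_mul c, ‖c‖ * K, fun z hz => ?_⟩
  rw [norm_mul, mul_div_assoc]
  exact mul_le_mul_of_nonneg_left (hK z hz) (norm_nonneg c)

theorem deriv (hf : StripDecay f) : StripDecay (deriv f) := by
  obtain ⟨η, hη, hd, K, hK⟩ := hf
  have hK0 : 0 ≤ K := by simpa using (norm_nonneg _).trans (hK 0 (by simpa using hη))
  obtain ⟨ε, hε, hεη, hε_half⟩ : ∃ ε > 0, ε ≤ η / 2 ∧ ε ≤ 1 / 2 :=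
    ⟨min (η / 2) (1 / 2), by positivity, min_le_left _ _, min_le_right _ _⟩
  refine ⟨η / 2, half_pos hη, (hd.deriv (isOpen_strip η)).mono fun z hz =>
    lt_trans hz (half_lt_self hη), 2 * K / ε, fun z hz => ?_⟩
  have hball : ∀ w ∈ Metric.closedBall z ε, |w.im| < η := fun w hw => by
    have him : |(w - z).im| ≤ ε :=
      (Complex.abs_im_le_norm _).trans (by simpa [dist_eq_norm] using hw)
    have := abs_add_le (w - z).im z.im
    rw [← Complex.add_im, sub_add_cancel] at this
    linarith
  have hbound : ∀ w ∈ Metric.sphere z ε, ‖f w‖ ≤ 2 * K / (1 + z.re ^ 2) := fun w hw => by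
    have hw' := Metric.sphere_subset_closedBall hw
    refine (hK w (hball w hw')).trans ?_
    rw [div_le_div_iff₀ (by positivity) (by positivity)]
    have hre : |(w - z).re| ≤ 1 / 2 :=
      ((Complex.abs_re_le_norm _).trans (by simpa [dist_eq_norm] using hw')).trans hε_half
    rw [Complex.sub_re] at hre
    have : 1 + z.re ^ 2 ≤ 2 * (1 + w.re ^ 2) := by
      nlinarith [sq_nonneg (w.re + (w.re - z.re)), abs_le.1 hre]
    nlinarith
  refine (Complex.norm_deriv_le_of_forall_mem_sphere_norm_le hε
    (hd.diffContOnCl_ball hball) hbound).trans_eq ?_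
  field_simp

theorem diffProd (hf : StripDecay f) (l : List ℝ) : StripDecay (diffProd l f) := by
  induction l with
  | nil => exact hf
  | cons c l ih => exact ih.sub (ih.deriv.const_mul _)

end StripDecay

theorem norm_expo (α t : ℝ) : ‖expo α t‖ = 1 := by
  have : (2 * Real.pi * Complex.I * α * t : ℂ) = ((2 * Real.pi * α * t : ℝ) : ℂ) * Complex.I := by
    push_cast; ring
  rw [expo, this, Complex.norm_exp_ofReal_mul_I]

theorem hasDerivAt_expo (α t : ℝ) :
    HasDerivAt (expo α) (2 * Real.pi * Complex.I * α * expo α t) t := by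
  have h := ((hasDerivAt_id (t : ℂ)).const_mul (2 * Real.pi * Complex.I * α : ℂ)).cexp
  simp only [mul_one] at h
  exact h.comp_ofReal.congr_deriv (mul_comm (Complex.exp _) _)

theorem continuous_expo (α : ℝ) : Continuous (expo α) :=
  continuous_iff_continuousAt.2 fun t => (hasDerivAt_expo α t).continuousAt

theorem integrable_expo_mul {f : ℝ → ℂ} (hf : Integrable f) (α : ℝ) :
    Integrable fun x => expo α x * f x :=
  hf.bdd_mul (c := 1) (continuous_expo α).aestronglyMeasurable
    (Eventually.of_forall fun x => (norm_expo α x).le)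

theorem integral_expo_mul_deriv {f : ℂ → ℂ} (hf : StripDecay f) (α : ℝ) :
    ∫ x : ℝ, expo α x * deriv f x = -(2 * Real.pi * Complex.I * α * ∫ x : ℝ, expo α x * f x) := by
  have hint : Integrable fun x : ℝ => 2 * Real.pi * Complex.I * α * expo α x * f x := by
    simpa only [mul_assoc] using
      (integrable_expo_mul hf.integrable_ofReal α).const_mul (2 * Real.pi * Complex.I * α : ℂ)
  rw [integral_mul_deriv_eq_deriv_mul_of_integrable (fun x _ => hasDerivAt_expo α x)
    (fun x _ => (hf.differentiableAt_ofReal x).hasDerivAt.comp_ofReal)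
    (integrable_expo_mul hf.deriv.integrable_ofReal α) hint
    (integrable_expo_mul hf.integrable_ofReal α), ← integral_const_mul]
  simp only [mul_assoc]

theorem integral_expo_mul_diffProd {f : ℂ → ℂ} (hf : StripDecay f) (α : ℝ) (l : List ℝ) :
    ∫ x : ℝ, expo α x * diffProd l f x
      = (l.map fun c : ℝ => (1 - 2 * Real.pi * c * α : ℂ)).prod * ∫ x : ℝ, expo α x * f x := by
  induction l with
  | nil => simp [diffProd]
  | cons c l ih =>
    have hl := hf.diffProd l
    have hsub : ∫ x : ℝ, expo α x * diffProd (c :: l) f x = (∫ x : ℝ, expo α x * diffProd l f x)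
        - Complex.I * c * ∫ x : ℝ, expo α x * deriv (diffProd l f) x := by
      rw [← integral_const_mul, ← integral_sub (integrable_expo_mul hl.integrable_ofReal α)
        ((integrable_expo_mul hl.deriv.integrable_ofReal α).const_mul _)]
      congr 1; ext x; simp only [diffProd]; ring
    rw [hsub, integral_expo_mul_deriv hl, ih, List.map_cons, List.prod_cons]
    linear_combination (2 * Real.pi * c * α * ((l.map fun c : ℝ =>
      (1 - 2 * Real.pi * c * α : ℂ)).prod * ∫ x : ℝ, expo α x * f x)) * Complex.I_mul_I

/-! ### Bounded holomorphic functions on the lower half-plane -/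

/-- `f` is bounded and holomorphic on a half-plane `Im z < η` with `η > 0`. -/
def BddHalfPlane (f : ℂ → ℂ) : Prop :=
  ∃ η > 0, DifferentiableOn ℂ f {z | z.im < η} ∧ ∃ K : ℝ, ∀ z : ℂ, z.im < η → ‖f z‖ ≤ K

theorem isOpen_halfPlane (η : ℝ) : IsOpen {z : ℂ | z.im < η} :=
  isOpen_lt (by fun_prop) continuous_const

namespace BddHalfPlane

variable {f g : ℂ → ℂ}

theorem differentiableAt (hf : BddHalfPlane f) {z : ℂ} (hz : z.im ≤ 0) :
    DifferentiableAt ℂ f z := by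
  obtain ⟨η, hη, hd, -⟩ := hf
  exact hd.differentiableAt ((isOpen_halfPlane η).mem_nhds (hz.trans_lt hη))

theorem continuous_ofReal (hf : BddHalfPlane f) : Continuous fun x : ℝ => f x :=
  continuous_iff_continuousAt.2 fun x => (hf.differentiableAt (by simp)).continuousAt.comp
    Complex.continuous_ofReal.continuousAt

theorem const (c : ℂ) : BddHalfPlane fun _ => c :=
  ⟨1, one_pos, differentiableOn_const _, ‖c‖, fun _ _ => le_rfl⟩

theorem congr (hf : BddHalfPlane f) {η : ℝ} (hη : 0 < η) (h : ∀ z : ℂ, z.im < η → g z = f z) :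
    BddHalfPlane g := by
  obtain ⟨θ, hθ, hfd, K, hK⟩ := hf
  refine ⟨min η θ, lt_min hη hθ, ?_, K, fun z hz => ?_⟩
  · exact (hfd.mono fun z (hz : z.im < min η θ) => (lt_min_iff.1 hz).2).congr fun z hz =>
      h z (lt_min_iff.1 hz).1
  · rw [h z (lt_min_iff.1 hz).1]
    exact hK z (lt_min_iff.1 hz).2

theorem add (hf : BddHalfPlane f) (hg : BddHalfPlane g) : BddHalfPlane fun z => f z + g z := by
  obtain ⟨η, hη, hfd, K, hK⟩ := hf
  obtain ⟨θ, hθ, hgd, J, hJ⟩ := hg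
  refine ⟨min η θ, lt_min hη hθ, ?_, K + J, fun z hz => ?_⟩
  · exact (hfd.mono fun z (hz : z.im < min η θ) => (lt_min_iff.1 hz).1).add
      (hgd.mono fun z (hz : z.im < min η θ) => (lt_min_iff.1 hz).2)
  · exact (norm_add_le _ _).trans (add_le_add (hK z (lt_min_iff.1 hz).1) (hJ z (lt_min_iff.1 hz).2))

theorem mul (hf : BddHalfPlane f) (hg : BddHalfPlane g) : BddHalfPlane fun z => f z * g z := by
  obtain ⟨η, hη, hfd, K, hK⟩ := hf
  obtain ⟨θ, hθ, hgd, J, hJ⟩ := hg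
  refine ⟨min η θ, lt_min hη hθ, ?_, K * J, fun z hz => ?_⟩
  · exact (hfd.mono fun z (hz : z.im < min η θ) => (lt_min_iff.1 hz).1).mul
      (hgd.mono fun z (hz : z.im < min η θ) => (lt_min_iff.1 hz).2)
  · obtain ⟨hzη, hzθ⟩ := lt_min_iff.1 hz
    rw [norm_mul]
    exact mul_le_mul (hK z hzη) (hJ z hzθ) (norm_nonneg _) ((norm_nonneg _).trans (hK z hzη))

theorem pow (hf : BddHalfPlane f) (n : ℕ) : BddHalfPlane fun z => f z ^ n := by
  induction n with
  | zero => simpa only [pow_zero] using const 1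
  | succ n ih => simpa only [pow_succ] using ih.mul hf

theorem sum {ι : Type*} (s : Finset ι) {F : ι → ℂ → ℂ} (hF : ∀ i ∈ s, BddHalfPlane (F i)) :
    BddHalfPlane fun z => ∑ i ∈ s, F i z := by
  classical
  induction s using Finset.induction_on with
  | empty => simpa only [Finset.sum_empty] using const 0
  | insert a s ha ih =>
    simp only [Finset.sum_insert ha]
    exact (hF a (by simp)).add (ih fun i hi => hF i (by simp [hi]))

theorem cexp (hf : BddHalfPlane f) : BddHalfPlane fun z => Complex.exp (f z) := by
  obtain ⟨η, hη, hd, K, hK⟩ := hf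
  refine ⟨η, hη, hd.cexp, Real.exp K, fun z hz => ?_⟩
  rw [Complex.norm_exp]
  exact Real.exp_le_exp.2 ((Complex.re_le_norm _).trans (hK z hz))

theorem comp_div (hf : BddHalfPlane f) {s : ℝ} (hs : 0 < s) :
    BddHalfPlane fun z => f (z / s) := by
  obtain ⟨η, hη, hd, K, hK⟩ := hf
  have hmaps : ∀ z : ℂ, z.im < s * η → (z / s).im < η := fun z hz => by
    rwa [Complex.div_ofReal_im, div_lt_iff₀' hs]
  exact ⟨s * η, mul_pos hs hη, hd.comp (by fun_prop) hmaps, K, fun z hz => hK _ (hmaps z hz)⟩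

theorem one_div_sub {p : ℂ} (hp : 0 < p.im) : BddHalfPlane fun z => 1 / (z - p) := by
  have hlt : ∀ z : ℂ, z.im < p.im / 2 → p.im / 2 < ‖z - p‖ := fun z hz =>
    lt_of_lt_of_le (by rw [Complex.sub_im, abs_sub_comm]; exact lt_abs.2 (.inl (by linarith)))
      (Complex.abs_im_le_norm _)
  refine ⟨p.im / 2, half_pos hp, ?_, 1 / (p.im / 2), fun z hz => ?_⟩
  · refine DifferentiableOn.div (by fun_prop) (by fun_prop) fun z hz => ?_
    exact norm_pos_iff.1 ((half_pos hp).trans (hlt z hz))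
  · rw [norm_div, norm_one]
    exact one_div_le_one_div_of_le (half_pos hp) (hlt z hz).le

end BddHalfPlane

theorem norm_intervalIntegral_le_of_lowerHalfPlane {F : ℂ → ℂ}
    (hF : ∀ z : ℂ, z.im ≤ 0 → DifferentiableAt ℂ F z) {R M : ℝ} (hR : 0 ≤ R)
    (hM : ∀ z : ℂ, z.im ≤ 0 → R ≤ ‖z‖ → ‖F z‖ ≤ M) :
    ‖∫ x : ℝ in (-R)..R, F x‖ ≤ 4 * (R * M) := by
  have hrect := Complex.integral_boundary_rect_eq_zero_of_differentiableOn F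
    (⟨-R, -R⟩ : ℂ) (⟨R, 0⟩ : ℂ) fun z hz => (hF z (by
      have him := hz.2
      rw [mem_preimage, uIcc_of_le (by simpa using hR)] at him
      exact him.2)).differentiableWithinAt
  simp only [Complex.ofReal_zero, zero_mul, add_zero] at hrect
  have bottom : ‖∫ x : ℝ in (-R)..R, F (x + (-R : ℝ) * Complex.I)‖ ≤ M * |R - -R| := by
    refine intervalIntegral.norm_integral_le_of_norm_le_const fun x _ => hM _ (by simpa using hR) ?_
    simpa [abs_of_nonneg hR] using Complex.abs_im_le_norm (x + (-R : ℝ) * Complex.I)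
  have side : ∀ s : ℝ, |s| = R → ‖∫ y : ℝ in (-R)..0, F (s + y * Complex.I)‖ ≤ M * |0 - -R| := by
    intro s hs
    refine intervalIntegral.norm_integral_le_of_norm_le_const fun y hy => hM _ ?_ ?_
    · rw [uIoc_of_le (by linarith)] at hy
      simpa using hy.2
    · simpa [hs] using Complex.abs_re_le_norm (s + y * Complex.I)
  have right := side R (abs_of_nonneg hR)
  have left := side (-R) (by rw [abs_neg, abs_of_nonneg hR])
  rw [sub_neg_eq_add, abs_of_nonneg (by linarith)] at bottom
  rw [zero_sub, neg_neg, abs_of_nonneg hR] at right left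
  have hsplit : (∫ x : ℝ in (-R)..R, F x) = (∫ x : ℝ in (-R)..R, F (x + (-R : ℝ) * Complex.I))
      + (Complex.I • ∫ y : ℝ in (-R)..0, F ((R : ℝ) + y * Complex.I))
      - Complex.I • ∫ y : ℝ in (-R)..0, F ((-R : ℝ) + y * Complex.I) := by
    linear_combination -hrect
  rw [hsplit]
  refine (norm_sub_le _ _).trans ((add_le_add_left (norm_add_le _ _) _).trans ?_)
  rw [norm_smul, norm_smul, Complex.norm_I, one_mul, one_mul]
  linarith

theorem integral_eq_zero_of_lowerHalfPlane {F : ℂ → ℂ}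
    (hF : ∀ z : ℂ, z.im ≤ 0 → DifferentiableAt ℂ F z) (hint : Integrable fun x : ℝ => F x)
    {M : ℝ → ℝ} (hM : ∀ᶠ R in atTop, ∀ z : ℂ, z.im ≤ 0 → R ≤ ‖z‖ → ‖F z‖ ≤ M R)
    (hlim : Tendsto (fun R => R * M R) atTop (𝓝 0)) :
    ∫ x : ℝ, F x = 0 := by
  refine tendsto_nhds_unique
    (intervalIntegral_tendsto_integral hint tendsto_neg_atTop_atBot tendsto_id) ?_
  refine squeeze_zero_norm' ?_ (by simpa using hlim.const_mul 4)
  filter_upwards [eventually_ge_atTop 0, hM] with R hR hMR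
  exact norm_intervalIntegral_le_of_lowerHalfPlane hF hR hMR

theorem ofReal_sq_add_sq_ne_zero {Y : ℝ} (hY : Y ≠ 0) (x : ℝ) :
    (x : ℂ) ^ 2 + (Y : ℂ) ^ 2 ≠ 0 := by
  exact_mod_cast (show x ^ 2 + Y ^ 2 ≠ 0 by positivity)

theorem integrable_one_div_sq_add_sq {Y : ℝ} (hY : Y ≠ 0) :
    Integrable fun x : ℝ => 1 / (x ^ 2 + Y ^ 2) := by
  refine ((integrable_inv_one_add_sq.comp_mul_left' (inv_ne_zero hY)).const_mul
    ((Y ^ 2)⁻¹)).congr (Eventually.of_forall fun x => ?_)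
  simp only
  field_simp
  ring

theorem integral_one_div_sq_add_sq {Y : ℝ} (hY : 0 < Y) :
    ∫ x : ℝ, 1 / (x ^ 2 + Y ^ 2) = Real.pi / Y := by
  have hscale : (fun x : ℝ => 1 / (x ^ 2 + Y ^ 2))
      = fun x => (Y ^ 2)⁻¹ * (1 + (Y⁻¹ * x) ^ 2)⁻¹ := by
    ext x
    field_simp
    ring
  rw [hscale, integral_const_mul, Measure.integral_comp_mul_left (fun x : ℝ => (1 + x ^ 2)⁻¹) Y⁻¹,
    integral_univ_inv_one_add_sq, inv_inv, abs_of_pos hY, smul_eq_mul]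
  field_simp

theorem integrable_div_sq_add_sq {Y : ℝ} (hY : Y ≠ 0) {f : ℝ → ℂ} (hf : Continuous f) {K : ℝ}
    (hK : ∀ x, ‖f x‖ ≤ K) : Integrable fun x : ℝ => f x / ((x : ℂ) ^ 2 + (Y : ℂ) ^ 2) := by
  refine ((integrable_one_div_sq_add_sq hY).const_mul K).mono'
    (Continuous.aestronglyMeasurable
      (hf.div (by fun_prop) (ofReal_sq_add_sq_ne_zero hY)))
    (Eventually.of_forall fun x => ?_)
  have hnorm : ‖(x : ℂ) ^ 2 + (Y : ℂ) ^ 2‖ = x ^ 2 + Y ^ 2 := by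
    rw [← Complex.ofReal_pow, ← Complex.ofReal_pow, ← Complex.ofReal_add,
      Complex.norm_of_nonneg (by positivity)]
  rw [norm_div, hnorm, mul_one_div]
  gcongr
  exact hK x

theorem tendsto_self_mul_div_sub_sq (K Y : ℝ) :
    Tendsto (fun R : ℝ => R * (K / (R - Y) ^ 2)) atTop (𝓝 0) := by
  have hinv : Tendsto (fun R : ℝ => (R - Y)⁻¹) atTop (𝓝 0) :=
    tendsto_inv_atTop_zero.comp (tendsto_atTop_add_const_right atTop (-Y) tendsto_id)
  have hsum := (hinv.const_mul K).add ((hinv.pow 2).const_mul (K * Y))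
  rw [mul_zero, zero_pow two_ne_zero, mul_zero, add_zero] at hsum
  refine hsum.congr' ?_
  filter_upwards [eventually_gt_atTop Y] with R hR
  have : R - Y ≠ 0 := (sub_pos.2 hR).ne'
  field_simp
  ring

theorem BddHalfPlane.integrable_div_sq_add_sq {h : ℂ → ℂ} (hh : BddHalfPlane h) {Y : ℝ}
    (hY : Y ≠ 0) : Integrable fun x : ℝ => h x / ((x : ℂ) ^ 2 + (Y : ℂ) ^ 2) := by
  have hcont := hh.continuous_ofReal
  obtain ⟨η, hη, -, K, hK⟩ := hh
  exact _root_.integrable_div_sq_add_sq hY hcont fun x => hK x (by simpa using hη)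

theorem BddHalfPlane.integral_div_sq_add_sq_eq_zero {h : ℂ → ℂ} (hh : BddHalfPlane h) {Y : ℝ}
    (hY : 0 < Y) (hzero : h (-(Y * Complex.I)) = 0) :
    ∫ x : ℝ, h x / ((x : ℂ) ^ 2 + (Y : ℂ) ^ 2) = 0 := by
  have hint := hh.integrable_div_sq_add_sq hY.ne'
  obtain ⟨η, hη, hd, K, hK⟩ := hh
  obtain ⟨p, hp⟩ : ∃ p : ℂ, p = -(Y * Complex.I) := ⟨_, rfl⟩
  rw [← hp] at hzero
  have hp_im : p.im = -Y := by simp [hp]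
  have hp_norm : ‖p‖ = Y := by simp [hp, abs_of_pos hY]
  have hfactor : ∀ z : ℂ, (z - p) * (z + p) = z ^ 2 + (Y : ℂ) ^ 2 := fun z => by
    rw [hp]; linear_combination (-Y ^ 2 : ℂ) * Complex.I_sq
  -- `h z / (z² + Y²)` has a removable singularity at `p`
  have hquot : ∀ z : ℂ, z ≠ p →
      h z / (z ^ 2 + (Y : ℂ) ^ 2) = dslope h p z / (z + p) := fun z hz => by
    rw [dslope_of_ne _ hz, slope_def_field, hzero, sub_zero, div_div, hfactor]
  have hreal : ∀ x : ℝ, h x / ((x : ℂ) ^ 2 + (Y : ℂ) ^ 2) = dslope h p x / (x + p) := fun x =>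
    hquot x fun hx => by simpa [hp_im, hY.ne'] using congrArg Complex.im hx
  simp only [hreal] at hint ⊢
  refine integral_eq_zero_of_lowerHalfPlane (F := fun z => dslope h p z / (z + p))
    (M := fun R => K / (R - Y) ^ 2) (fun z hz => ?_) hint ?_ (tendsto_self_mul_div_sub_sq _ _)
  · have hne : z + p ≠ 0 := fun h0 => by
      have := congrArg Complex.im h0
      rw [Complex.add_im, hp_im, Complex.zero_im] at this
      linarith
    have hnhds : ∀ w : ℂ, w.im ≤ 0 → {z : ℂ | z.im < η} ∈ 𝓝 w := fun w hw =>
      (isOpen_halfPlane η).mem_nhds (hw.trans_lt hη)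
    exact (((Complex.differentiableOn_dslope (hnhds p (by linarith))).2 hd).differentiableAt
      (hnhds z hz)).div (by fun_prop) hne
  · filter_upwards [eventually_gt_atTop Y] with R hR z hz hRz
    have : 0 < R - Y := sub_pos.2 hR
    have hminus : R - Y ≤ ‖z - p‖ := by linarith [norm_sub_norm_le z p]
    have hplus : R - Y ≤ ‖z + p‖ := by
      have := norm_sub_norm_le z (-p)
      rw [norm_neg, sub_neg_eq_add] at this
      linarith
    rw [← hquot z (by rintro rfl; linarith), ← hfactor, norm_div, norm_mul, sq]
    have hKz := hK z (hz.trans_lt hη)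
    have := (norm_nonneg _).trans hKz
    gcongr

theorem BddHalfPlane.integral_div_sq_add_sq {h : ℂ → ℂ} (hh : BddHalfPlane h) {Y : ℝ}
    (hY : 0 < Y) :
    ∫ x : ℝ, h x / ((x : ℂ) ^ 2 + (Y : ℂ) ^ 2) = Real.pi / Y * h (-(Y * Complex.I)) := by
  obtain ⟨v, hv⟩ : ∃ v, v = h (-(Y * Complex.I)) := ⟨_, rfl⟩
  have hsub := (hh.add (const (-v))).integral_div_sq_add_sq_eq_zero hY (by rw [hv, add_neg_cancel])
  simp only [← sub_eq_add_neg, sub_div] at hsub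
  rw [integral_sub (hh.integrable_div_sq_add_sq hY.ne')
    ((const v).integrable_div_sq_add_sq hY.ne'), sub_eq_zero] at hsub
  have hkernel : ∀ x : ℝ, v / ((x : ℂ) ^ 2 + (Y : ℂ) ^ 2) = v * ((1 / (x ^ 2 + Y ^ 2) : ℝ) : ℂ) :=
    fun x => by push_cast; ring
  simp only [hkernel] at hsub
  rw [hsub, integral_const_mul, integral_complex_ofReal, integral_one_div_sq_add_sq hY, ← hv]
  push_cast
  ring

/-! ### Outer functions with prescribed growth -/

theorem sub_im_sq_le_norm_sq_add_sq (Y : ℝ) (z : ℂ) :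
    z.re ^ 2 + Y ^ 2 - z.im ^ 2 ≤ ‖z ^ 2 + (Y : ℂ) ^ 2‖ := by
  refine le_of_eq_of_le ?_ (Complex.re_le_norm _)
  rw [← Complex.ofReal_pow, Complex.add_re, Complex.ofReal_re, sq z, Complex.mul_re]
  ring

theorem BddHalfPlane.stripDecay {h : ℂ → ℂ} (hh : BddHalfPlane h) {Y : ℝ} (hY : 0 < Y) :
    StripDecay fun z => h z / (z ^ 2 + (Y : ℂ) ^ 2) := by
  obtain ⟨η, hη, hd, K, hK⟩ := hh
  obtain ⟨m, hm, hm_one, hmY⟩ : ∃ m > 0, m ≤ 1 ∧ m ≤ Y ^ 2 / 2 :=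
    ⟨min 1 (Y ^ 2 / 2), by positivity, min_le_left _ _, min_le_right _ _⟩
  have hkernel : ∀ z : ℂ, |z.im| < min η (Y / 2) →
      m * (1 + z.re ^ 2) ≤ ‖z ^ 2 + (Y : ℂ) ^ 2‖ := fun z hz => by
    have hz_im : z.im ^ 2 ≤ (Y / 2) ^ 2 := sq_le_sq.2 <| by
      rw [abs_of_pos (half_pos hY)]
      exact (hz.trans_le (min_le_right _ _)).le
    nlinarith [sub_im_sq_le_norm_sq_add_sq Y z, mul_le_of_le_one_left (sq_nonneg z.re) hm_one]
  have hη_of : ∀ z : ℂ, |z.im| < min η (Y / 2) → z.im < η := fun z hz =>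
    (le_abs_self _).trans_lt (hz.trans_le (min_le_left _ _))
  refine ⟨min η (Y / 2), by positivity, (hd.mono hη_of).div (by fun_prop) fun z hz => ?_,
    K / m, fun z hz => ?_⟩
  · exact norm_pos_iff.1 (lt_of_lt_of_le (by positivity) (hkernel z hz))
  · have hKz := hK z (hη_of z hz)
    have := (norm_nonneg _).trans hKz
    rw [norm_div, div_div]
    gcongr
    exact hkernel z hz

theorem bddHalfPlane_exp {μ : ℝ} (hμ : μ ≤ 0) :
    BddHalfPlane fun z => Complex.exp (2 * Real.pi * Complex.I * μ * z) := by
  refine ⟨1, one_pos, by fun_prop, Real.exp (2 * Real.pi * -μ), fun z hz => ?_⟩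
  have hre : (2 * Real.pi * Complex.I * μ * z).re = 2 * Real.pi * -μ * z.im := by simp
  rw [Complex.norm_exp, hre]
  exact Real.exp_le_exp.2 (mul_le_of_le_one_right (by have := neg_nonneg.2 hμ; positivity) hz.le)

theorem BddHalfPlane.integral_expo_mul_div {h : ℂ → ℂ} (hh : BddHalfPlane h) {Y μ : ℝ}
    (hY : 0 < Y) (hμ : μ ≤ 0) :
    ∫ x : ℝ, expo μ x * (h x / ((x : ℂ) ^ 2 + (Y : ℂ) ^ 2))
      = Real.pi / Y * (Real.exp (2 * Real.pi * μ * Y) * h (-(Y * Complex.I))) := by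
  have hexp : (2 * Real.pi * Complex.I * μ * -(Y * Complex.I) : ℂ)
      = ((2 * Real.pi * μ * Y : ℝ) : ℂ) := by
    push_cast
    linear_combination (-(2 * Real.pi * μ * Y) : ℂ) * Complex.I_sq
  rw [Complex.ofReal_exp, ← hexp, ← ((bddHalfPlane_exp hμ).mul hh).integral_div_sq_add_sq hY]
  simp only [expo, mul_div_assoc]

/-- A rational function with its pole at `2 + i`, whose real part on the real line is positive on
`(0, 4)` and nonpositive elsewhere. -/
noncomputable def bump (z : ℂ) : ℂ :=
  -(Complex.I * (1 / (z - (2 + Complex.I)))) - 5 / 3 * (1 / (z - (2 + Complex.I))) ^ 2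

theorem bddHalfPlane_bump : BddHalfPlane bump := by
  have hinv : BddHalfPlane fun z => 1 / (z - (2 + Complex.I)) := .one_div_sub (by simp)
  convert ((BddHalfPlane.const (-Complex.I)).mul hinv).add
    ((BddHalfPlane.const (-(5 / 3))).mul (hinv.pow 2)) using 2 with z
  rw [bump]
  ring

theorem bump_re (z : ℂ) :
    (bump z).re = (1 - z.im) / ((z.re - 2) ^ 2 + (1 - z.im) ^ 2)
      - 5 / 3 * (((z.re - 2) ^ 2 - (1 - z.im) ^ 2) / ((z.re - 2) ^ 2 + (1 - z.im) ^ 2) ^ 2) := by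
  have hD : Complex.normSq (z - (2 + Complex.I)) = (z.re - 2) ^ 2 + (1 - z.im) ^ 2 := by
    rw [Complex.normSq_apply]
    simp only [Complex.sub_re, Complex.add_re, Complex.re_ofNat, Complex.I_re, add_zero,
      Complex.sub_im, Complex.add_im, Complex.im_ofNat, Complex.I_im, zero_add]
    ring
  have hre (u : ℂ) :
      (-(Complex.I * u) - 5 / 3 * u ^ 2).re = u.im - 5 / 3 * (u.re ^ 2 - u.im ^ 2) := by
    have : (5 / 3 : ℂ) = ((5 / 3 : ℝ) : ℂ) := by push_cast; rfl
    rw [this, Complex.sub_re, Complex.re_ofReal_mul, sq, Complex.mul_re]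
    simp only [Complex.neg_re, Complex.mul_re, Complex.I_re, zero_mul, Complex.I_im, one_mul,
      zero_sub, neg_neg]
    ring
  rw [bump, hre, one_div, Complex.inv_re, Complex.inv_im, hD]
  generalize (z.re - 2) ^ 2 + (1 - z.im) ^ 2 = D
  simp only [Complex.sub_im, Complex.add_im, Complex.im_ofNat, Complex.I_im, zero_add,
    Complex.sub_re, Complex.add_re, Complex.re_ofNat, Complex.I_re, add_zero]
  ring

theorem bump_re_ofReal (x : ℝ) :
    (bump x).re = 2 / 3 * (x * (4 - x)) / ((x - 2) ^ 2 + 1) ^ 2 := by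
  rw [bump_re, Complex.ofReal_re, Complex.ofReal_im]
  have : (x - 2) ^ 2 + 1 ≠ 0 := by positivity
  field_simp
  ring

theorem bump_re_nonpos {x : ℝ} (hx : x ≤ 0 ∨ 4 ≤ x) : (bump x).re ≤ 0 := by
  rw [bump_re_ofReal]
  refine div_nonpos_of_nonpos_of_nonneg (mul_nonpos_of_nonneg_of_nonpos (by norm_num) ?_)
    (by positivity)
  rcases hx with hx | hx
  · exact mul_nonpos_of_nonpos_of_nonneg hx (by linarith)
  · exact mul_nonpos_of_nonneg_of_nonpos (by linarith) (by linarith)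

theorem bump_re_le (x : ℝ) : (bump x).re ≤ 8 / 3 := by
  rw [bump_re_ofReal, div_le_iff₀ (by positivity)]
  nlinarith [sq_nonneg ((x - 2) ^ 2), sq_nonneg (x - 2)]

theorem le_bump_re_neg_mul_I {Y : ℝ} (hY : 1 ≤ Y) :
    1 / (4 * Y) ≤ (bump (-(Y * Complex.I))).re := by
  have hre : (-(Y * Complex.I)).re = 0 := by simp
  have him : (-(Y * Complex.I)).im = -Y := by simp
  rw [bump_re, hre, him, zero_sub, neg_sq, sub_neg_eq_add]
  have hfirst : 1 / (4 * Y) ≤ (1 + Y) / (2 ^ 2 + (1 + Y) ^ 2) := by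
    rw [div_le_div_iff₀ (by positivity) (by positivity)]
    nlinarith
  have hsecond : (2 ^ 2 - (1 + Y) ^ 2) / (2 ^ 2 + (1 + Y) ^ 2) ^ 2 ≤ 0 :=
    div_nonpos_of_nonpos_of_nonneg (by nlinarith) (by positivity)
  linarith

theorem norm_quadratic_sub_le {u v : ℂ} (hu : ‖u‖ ≤ 2) (hv : ‖v‖ ≤ 1) :
    ‖(-(Complex.I * u) - 5 / 3 * u ^ 2) - (-(Complex.I * v) - 5 / 3 * v ^ 2)‖ ≤ 6 * ‖u - v‖ := by
  have hfactor : (-(Complex.I * u) - 5 / 3 * u ^ 2) - (-(Complex.I * v) - 5 / 3 * v ^ 2)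
      = -(Complex.I + 5 / 3 * (u + v)) * (u - v) := by ring
  rw [hfactor, norm_mul, norm_neg]
  gcongr
  calc ‖Complex.I + 5 / 3 * (u + v)‖ ≤ ‖Complex.I‖ + ‖(5 / 3 : ℂ)‖ * (‖u‖ + ‖v‖) :=
        (norm_add_le _ _).trans (by rw [norm_mul]; gcongr; exact norm_add_le _ _)
    _ ≤ 1 + 5 / 3 * (2 + 1) := by rw [Complex.norm_I]; norm_num; linarith
    _ = 6 := by norm_num

theorem norm_bump_sub_le {x ρ : ℝ} (hx : x ≠ 0) {ζ : ℂ} (hζ : ‖ζ - x‖ ≤ ρ) (hρ : ρ ≤ |x| / 20) :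
    ‖bump ζ - bump x‖ ≤ 60 * ρ / x ^ 2 := by
  obtain ⟨p, hp⟩ : ∃ p : ℂ, p = 2 + Complex.I := ⟨_, rfl⟩
  have hsq : ‖(x : ℂ) - p‖ ^ 2 = (x - 2) ^ 2 + 1 := by
    rw [Complex.sq_norm, Complex.normSq_apply, hp]
    simp only [Complex.sub_re, Complex.ofReal_re, Complex.add_re, Complex.re_ofNat, Complex.I_re,
      add_zero, Complex.sub_im, Complex.ofReal_im, Complex.add_im, Complex.im_ofNat, Complex.I_im,
      zero_add]
    ring
  have hx_sq : x ^ 2 ≤ 5 * ‖(x : ℂ) - p‖ ^ 2 := by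
    rw [hsq]; nlinarith [sq_nonneg (2 * x - 5)]
  have hone : 1 ≤ ‖(x : ℂ) - p‖ := one_le_sq_iff₀ (norm_nonneg _) |>.1 <| by
    rw [hsq]; exact le_add_of_nonneg_left (sq_nonneg _)
  have hxp : |x| ≤ 3 * ‖(x : ℂ) - p‖ := abs_le_of_sq_le_sq (by nlinarith) (by positivity)
  have hζp : ‖(x : ℂ) - p‖ / 2 ≤ ‖ζ - p‖ := by
    have := norm_sub_norm_le ((x : ℂ) - p) (x - ζ)
    rw [sub_sub_sub_cancel_left, norm_sub_rev (x : ℂ) ζ] at this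
    linarith
  have hne : (x : ℂ) - p ≠ 0 := norm_pos_iff.1 (by linarith)
  have hne' : ζ - p ≠ 0 := norm_pos_iff.1 (by linarith)
  have hv : ‖1 / ((x : ℂ) - p)‖ ≤ 1 := by
    rw [norm_div, norm_one]; exact div_le_one_of_le₀ hone (norm_nonneg _)
  have hu : ‖1 / (ζ - p)‖ ≤ 2 / ‖(x : ℂ) - p‖ := by
    rw [norm_div, norm_one, div_le_div_iff₀ (by linarith) (by linarith)]
    linarith
  have huv : ‖1 / (ζ - p) - 1 / ((x : ℂ) - p)‖ ≤ 10 * ρ / x ^ 2 := by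
    rw [one_div, one_div, inv_sub_inv hne' hne, sub_sub_sub_cancel_right, norm_div, norm_mul,
      norm_sub_rev]
    have hprod : x ^ 2 / 10 ≤ ‖ζ - p‖ * ‖(x : ℂ) - p‖ := by nlinarith
    have := (norm_nonneg _).trans hζ
    calc ‖ζ - x‖ / (‖ζ - p‖ * ‖(x : ℂ) - p‖) ≤ ρ / (x ^ 2 / 10) := by gcongr
      _ = 10 * ρ / x ^ 2 := by field_simp
  rw [bump, bump, ← hp]
  calc _ ≤ 6 * ‖1 / (ζ - p) - 1 / ((x : ℂ) - p)‖ := norm_quadratic_sub_le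
        (hu.trans (div_le_self zero_le_two hone)) hv
    _ ≤ 6 * (10 * ρ / x ^ 2) := by gcongr
    _ = 60 * ρ / x ^ 2 := by ring

/-- The sum of the bumps of heights `c n` and widths `s n`; its real part is the logarithm of the
modulus of an outer function. -/
noncomputable def potential {ι : Type*} (S : Finset ι) (c s : ι → ℝ) (z : ℂ) : ℂ :=
  ∑ n ∈ S, (c n : ℂ) * bump (z / s n)

theorem potential_re {ι : Type*} (S : Finset ι) (c s : ι → ℝ) (z : ℂ) :
    (potential S c s z).re = ∑ n ∈ S, c n * (bump (z / s n)).re := by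
  simp only [potential, Complex.re_sum, Complex.re_ofReal_mul]

theorem potential_re_ofReal_le {ι : Type*} {S : Finset ι} {c : ι → ℝ} (hc : ∀ n ∈ S, 0 ≤ c n)
    (s : ι → ℝ) (x : ℝ) : (potential S c s x).re ≤ ∑ n ∈ S, c n * (8 / 3) := by
  rw [potential_re]
  refine Finset.sum_le_sum fun n hn => mul_le_mul_of_nonneg_left ?_ (hc n hn)
  rw [← Complex.ofReal_div]
  exact bump_re_le _

theorem bddHalfPlane_potential {ι : Type*} {S : Finset ι} (c : ι → ℝ) {s : ι → ℝ}
    (hs : ∀ n ∈ S, 0 < s n) : BddHalfPlane (potential S c s) :=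
  .sum S fun n hn => (BddHalfPlane.const _).mul (bddHalfPlane_bump.comp_div (hs n hn))

theorem le_potential_re_neg_mul_I {ι : Type*} {S : Finset ι} {c s : ι → ℝ}
    (hc : ∀ n ∈ S, 0 ≤ c n) (hs : ∀ n ∈ S, 0 < s n) {Y : ℝ} (hY : ∀ n ∈ S, s n ≤ Y) :
    (∑ n ∈ S, c n * s n) / (4 * Y) ≤ (potential S c s (-(Y * Complex.I))).re := by
  rw [potential_re, Finset.sum_div]
  refine Finset.sum_le_sum fun n hn => ?_
  have hscale : -(Y * Complex.I) / s n = -(((Y / s n : ℝ) : ℂ) * Complex.I) := by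
    push_cast; ring
  have hbump := le_bump_re_neg_mul_I ((one_le_div (hs n hn)).2 (hY n hn))
  rw [hscale, mul_div_assoc]
  refine mul_le_mul_of_nonneg_left (le_of_eq_of_le ?_ hbump) (hc n hn)
  have := hs n hn
  field_simp

theorem potential_re_le {ι : Type*} {S : Finset ι} {c s : ι → ℝ} (hc : ∀ n ∈ S, 0 ≤ c n)
    (hs : ∀ n ∈ S, 0 < s n) {x ρ : ℝ} (hx : x ≠ 0) {ζ : ℂ} (hζ : ‖ζ - x‖ ≤ ρ)
    (hρ : ρ ≤ |x| / 20) :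
    (potential S c s ζ).re
      ≤ (potential S c s x).re + 60 * (∑ n ∈ S, c n * s n) * ρ / x ^ 2 := by
  rw [potential_re, potential_re, Finset.mul_sum, Finset.sum_mul, Finset.sum_div,
    ← Finset.sum_add_distrib]
  refine Finset.sum_le_sum fun n hn => ?_
  have hsn := hs n hn
  have hbump : (bump (ζ / s n)).re - (bump (x / s n)).re ≤ 60 * (ρ / s n) / (x / s n) ^ 2 := by
    rw [← Complex.sub_re, ← Complex.ofReal_div]
    refine (Complex.re_le_norm _).trans (norm_bump_sub_le (div_ne_zero hx hsn.ne') ?_ ?_)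
    · rw [Complex.ofReal_div, ← sub_div, norm_div, Complex.norm_of_nonneg hsn.le]
      gcongr
    · rw [abs_div, abs_of_pos hsn, div_right_comm]
      gcongr
  have hscale : c n * (60 * (ρ / s n) / (x / s n) ^ 2) = 60 * (c n * s n) * ρ / x ^ 2 := by
    field_simp
  rw [← hscale]
  linarith [mul_le_mul_of_nonneg_left hbump (hc n hn)]

/-- The product of the factors `z / (z - iδ)`. -/
noncomputable def damp (l : List ℝ) (z : ℂ) : ℂ :=
  (l.map fun δ : ℝ => z / (z - Complex.I * δ)).prod

theorem damp_cons (δ : ℝ) (l : List ℝ) (z : ℂ) :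
    damp (δ :: l) z = z / (z - Complex.I * δ) * damp l z := by
  rw [damp, List.map_cons, List.prod_cons, damp]

theorem bddHalfPlane_damp {l : List ℝ} (hl : ∀ δ ∈ l, 0 < δ) : BddHalfPlane (damp l) := by
  induction l with
  | nil => exact .const 1
  | cons δ l ih =>
    obtain ⟨hδ, hl⟩ := List.forall_mem_cons.1 hl
    have hpole : 0 < (Complex.I * δ).im := by simpa using hδ
    refine (((BddHalfPlane.const 1).add ((BddHalfPlane.const (Complex.I * δ)).mul
      (.one_div_sub hpole))).mul (ih hl)).congr hδ fun z hz => ?_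
    have : z - Complex.I * δ ≠ 0 := fun h => by
      simpa [hz.ne, sub_eq_zero] using congrArg Complex.im h
    rw [damp_cons]
    field_simp
    ring

theorem exp_neg_le_norm_damp_neg_mul_I {Y : ℝ} (hY : 0 < Y) {l : List ℝ} (hl : ∀ δ ∈ l, 0 ≤ δ) :
    Real.exp (-(l.sum / Y)) ≤ ‖damp l (-(Y * Complex.I))‖ := by
  induction l with
  | nil => simp [damp]
  | cons δ l ih =>
    obtain ⟨hδ, hl⟩ := List.forall_mem_cons.1 hl
    have hfactor : (-(Y * Complex.I) / (-(Y * Complex.I) - Complex.I * δ) : ℂ)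
        = ((1 + δ / Y)⁻¹ : ℝ) := by
      have h₁ : (-(Y * Complex.I) - Complex.I * δ : ℂ) = -(Complex.I * (Y + δ)) := by ring
      have h₂ : ((Y : ℂ) + δ) ≠ 0 := by exact_mod_cast (by positivity : Y + δ ≠ 0)
      have hY' : (Y : ℂ) ≠ 0 := by exact_mod_cast hY.ne'
      have := Complex.I_ne_zero
      rw [h₁]
      push_cast
      field_simp
    have hexp : Real.exp (-(δ / Y)) ≤ (1 + δ / Y)⁻¹ := by
      rw [Real.exp_neg, add_comm]
      exact inv_anti₀ (by positivity) (Real.add_one_le_exp _)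
    rw [damp_cons, norm_mul, hfactor, Complex.norm_of_nonneg (by positivity), List.sum_cons,
      add_div, neg_add, Real.exp_add]
    exact mul_le_mul hexp (ih hl) (Real.exp_nonneg _) (by positivity)

theorem norm_damp_ofReal_sq_mul {x : ℝ} (hx : x ≠ 0) (l : List ℝ) :
    ‖damp l x‖ ^ 2 * (l.map fun δ => 1 + δ ^ 2 / x ^ 2).prod = 1 := by
  induction l with
  | nil => simp [damp]
  | cons δ l ih =>
    have hpole : ‖(x : ℂ) - Complex.I * δ‖ ^ 2 = x ^ 2 + δ ^ 2 := by
      rw [Complex.sq_norm, Complex.normSq_apply]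
      simp only [Complex.sub_re, Complex.ofReal_re, Complex.mul_re, Complex.I_re, zero_mul,
        Complex.I_im, Complex.ofReal_im, mul_zero, Complex.sub_im, Complex.mul_im, one_mul]
      ring
    have hfactor : ‖(x : ℂ) / (x - Complex.I * δ)‖ ^ 2 * (1 + δ ^ 2 / x ^ 2) = 1 := by
      rw [norm_div, div_pow, hpole, Complex.norm_real, Real.norm_eq_abs, sq_abs]
      have : 0 < x ^ 2 := by positivity
      field_simp
    rw [damp_cons, norm_mul, mul_pow, List.map_cons, List.prod_cons, mul_mul_mul_comm, hfactor, ih,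
      one_mul]

theorem norm_div_sub_I_mul_le {x ρ δ : ℝ} (hx : x ≠ 0) (hδ : 0 ≤ δ) {ζ : ℂ} (hζ : ‖ζ - x‖ ≤ ρ)
    (hρ : ρ ≤ |x| / 20) :
    ‖ζ / (ζ - Complex.I * δ)‖
      ≤ ‖(x : ℂ) / (x - Complex.I * δ)‖ * Real.exp (2 * δ * ρ / x ^ 2) := by
  have hx_abs : 0 < |x| := abs_pos.2 hx
  have hxδ : |x| ≤ ‖(x : ℂ) - Complex.I * δ‖ := by
    simpa using Complex.abs_re_le_norm ((x : ℂ) - Complex.I * δ)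
  have hζδ : |x| / 2 ≤ ‖ζ - Complex.I * δ‖ := by
    have := norm_sub_norm_le ((x : ℂ) - Complex.I * δ) (x - ζ)
    rw [sub_sub_sub_cancel_left, norm_sub_rev (x : ℂ) ζ] at this
    linarith
  have hratio : ζ / (ζ - Complex.I * δ) = x / (x - Complex.I * δ)
      * (1 - Complex.I * δ * (ζ - x) / (x * (ζ - Complex.I * δ))) := by
    have h₁ : (x : ℂ) - Complex.I * δ ≠ 0 := norm_pos_iff.1 (hx_abs.trans_le hxδ)
    have h₂ : ζ - Complex.I * δ ≠ 0 := norm_pos_iff.1 (by linarith)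
    have h₃ : (x : ℂ) ≠ 0 := by exact_mod_cast hx
    field_simp
    ring
  rw [hratio, norm_mul]
  gcongr
  calc ‖1 - Complex.I * δ * (ζ - x) / (x * (ζ - Complex.I * δ))‖
      ≤ 1 + ‖Complex.I * δ * (ζ - x) / (x * (ζ - Complex.I * δ))‖ :=
        (norm_sub_le _ _).trans_eq (by rw [norm_one])
    _ = δ * ‖ζ - x‖ / (|x| * ‖ζ - Complex.I * δ‖) + 1 := by
        rw [norm_div, norm_mul, norm_mul, norm_mul, Complex.norm_I, one_mul, Complex.norm_real,
          Complex.norm_real, Real.norm_of_nonneg hδ, Real.norm_eq_abs, add_comm]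
    _ ≤ δ * ρ / (|x| * (|x| / 2)) + 1 := by
        have := (norm_nonneg _).trans hζ
        gcongr
    _ = 2 * δ * ρ / x ^ 2 + 1 := by rw [← sq_abs x]; field_simp
    _ ≤ Real.exp (2 * δ * ρ / x ^ 2) := Real.add_one_le_exp _

theorem norm_damp_le {x ρ : ℝ} (hx : x ≠ 0) {ζ : ℂ} (hζ : ‖ζ - x‖ ≤ ρ) (hρ : ρ ≤ |x| / 20)
    {l : List ℝ} (hl : ∀ δ ∈ l, 0 ≤ δ) :
    ‖damp l ζ‖ ≤ ‖damp l x‖ * Real.exp (2 * l.sum * ρ / x ^ 2) := by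
  induction l with
  | nil => simp [damp]
  | cons δ l ih =>
    obtain ⟨hδ, hl⟩ := List.forall_mem_cons.1 hl
    have hsum : 2 * (δ :: l).sum * ρ / x ^ 2 = 2 * δ * ρ / x ^ 2 + 2 * l.sum * ρ / x ^ 2 := by
      rw [List.sum_cons]; ring
    rw [damp_cons, damp_cons, norm_mul, norm_mul, hsum, Real.exp_add, mul_mul_mul_comm]
    exact mul_le_mul (norm_div_sub_I_mul_le hx hδ hζ hρ) (ih hl) (norm_nonneg _) (by positivity)

theorem exp_mul_growthRadius_le {R : ℝ} (hR : 0 ≤ R) {l : List ℝ} (hl : ∀ c ∈ l, 0 ≤ c) :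
    Real.exp (R * growthRadius R l) ≤ growthFactor R l := by
  induction l with
  | nil => simp [growthRadius, growthFactor]
  | cons c l ih =>
    obtain ⟨hc, hl⟩ := List.forall_mem_cons.1 hl
    have hfactor : Real.exp (R * (c / (1 + c * R))) ≤ 1 + c * R := by
      have hdiv : R * (c / (1 + c * R)) = 1 - (1 + c * R)⁻¹ := by field_simp; ring
      rw [hdiv, ← Real.le_log_iff_exp_le (by positivity)]
      exact Real.one_sub_inv_le_log_of_pos (by positivity)
    simp only [growthRadius, growthFactor, List.map_cons, List.sum_cons, List.prod_cons, mul_add,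
      Real.exp_add] at ih ⊢
    exact mul_le_mul hfactor (ih hl) (Real.exp_nonneg _) (by positivity)

theorem two_mul_growthRadius_le {R : ℝ} (hR : 0 < R) {l : List ℝ} (hl : ∀ c ∈ l, 0 ≤ c) :
    2 * growthRadius R l ≤ (l.map Real.sqrt).sum / √R := by
  have hsqrt := Real.sqrt_pos.2 hR
  rw [le_div_iff₀ hsqrt, growthRadius, mul_right_comm, ← List.sum_map_mul_left]
  refine List.sum_le_sum fun c hc => ?_
  have hc := hl c hc
  rw [← mul_div_assoc, div_le_iff₀ (by positivity)]
  have hsq : √c * (√c * √R - 1) ^ 2 = √c * (1 + c * R) - 2 * √R * c := by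
    rw [sub_sq, mul_pow, Real.sq_sqrt hc, Real.sq_sqrt hR.le]
    linear_combination (-2 * √R) * Real.sq_sqrt hc
  exact sub_nonneg.1 (hsq ▸ by positivity)

theorem analyticAt_bump {z : ℂ} (hz : z ≠ 2 + Complex.I) : AnalyticAt ℂ bump z := by
  have := sub_ne_zero.2 hz
  unfold bump
  fun_prop (disch := assumption)

theorem analyticAt_damp {z : ℂ} (hz : z.re ≠ 0) (l : List ℝ) : AnalyticAt ℂ (damp l) z := by
  induction l with
  | nil => exact analyticAt_const
  | cons δ l ih =>
    have hpole : z - Complex.I * δ ≠ 0 := fun h => hz (by simpa using congrArg Complex.re h)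
    rw [funext (damp_cons δ l)]
    have hden : AnalyticAt ℂ (fun z => z - Complex.I * δ) z := by fun_prop
    exact (analyticAt_id.fun_div hden hpole).fun_mul ih

/-- The holomorphic function whose modulus on the line is `exp` of the real part of
`potential S c s`, damped near the origin to make up for the growth caused by
`diffProd l`: with `δ² = A c` the damping factors satisfy
`|x / (x - iδ)| ^ 2 * (1 + c A / x²) = 1`. The tenth power gains five factors
`growthFactor (A / x²) l`: one is lost to `diffProd l`, four to the variation of the function over
the disc that `diffProd l` consumes. -/
noncomputable def dampedOuter {ι : Type*} (S : Finset ι) (c s : ι → ℝ) (A : ℝ) (l : List ℝ)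
    (z : ℂ) : ℂ :=
  Complex.exp (potential S c s z) * damp (l.map fun b => √(A * b)) z ^ 10

section DampedOuter

variable {ι : Type*} {S : Finset ι} {c s : ι → ℝ} {A : ℝ} {l : List ℝ}

theorem sum_map_sqrt_mul (hA : 0 ≤ A) (l : List ℝ) :
    (l.map fun b => √(A * b)).sum = √A * (l.map Real.sqrt).sum := by
  simp only [Real.sqrt_mul hA, List.sum_map_mul_left]

theorem bddHalfPlane_dampedOuter (hs : ∀ n ∈ S, 0 < s n) (hA : 0 < A) (hl : ∀ b ∈ l, 0 < b) :
    BddHalfPlane (dampedOuter S c s A l) :=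
  (bddHalfPlane_potential c hs).cexp.mul <| (bddHalfPlane_damp <| List.forall_mem_map.2
    fun b hb => Real.sqrt_pos.2 (mul_pos hA (hl b hb))).pow 10

theorem analyticAt_dampedOuter (hs : ∀ n ∈ S, 0 < s n) {z : ℂ} (hz : 2 * |z.im| < |z.re|) :
    AnalyticAt ℂ (dampedOuter S c s A l) z := by
  have hpotential : AnalyticAt ℂ (potential S c s) z := by
    refine Finset.analyticAt_fun_sum S fun n hn => analyticAt_const.fun_mul ?_
    refine (analyticAt_bump (z := z / s n) fun h => ?_).comp (f := fun z : ℂ => z / s n)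
      (analyticAt_id.div analyticAt_const (by exact_mod_cast (hs n hn).ne'))
    have hz' : z = (2 + Complex.I) * s n := (div_eq_iff (by exact_mod_cast (hs n hn).ne')).1 h
    simp [hz', abs_mul] at hz
  have hre : z.re ≠ 0 := abs_pos.1 ((by positivity : 0 ≤ 2 * |z.im|).trans_lt hz)
  exact hpotential.cexp.fun_mul ((analyticAt_damp hre _).fun_pow 10)

theorem exp_le_norm_dampedOuter_neg_mul_I (hc : ∀ n ∈ S, 0 ≤ c n) (hs : ∀ n ∈ S, 0 < s n)
    (hA : 0 ≤ A) {Y : ℝ} (hY : 0 < Y) (hsY : ∀ n ∈ S, s n ≤ Y) :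
    Real.exp ((∑ n ∈ S, c n * s n) / (4 * Y) - 10 * (√A * (l.map Real.sqrt).sum / Y))
      ≤ ‖dampedOuter S c s A l (-(Y * Complex.I))‖ := by
  have hdamp := exp_neg_le_norm_damp_neg_mul_I hY (l := l.map fun b => √(A * b))
    (List.forall_mem_map.2 fun b _ => Real.sqrt_nonneg _)
  rw [sum_map_sqrt_mul hA] at hdamp
  rw [dampedOuter, norm_mul, Complex.norm_exp, norm_pow, sub_eq_add_neg, ← mul_neg, Real.exp_add]
  gcongr
  · exact le_potential_re_neg_mul_I hc hs hsY
  · exact_mod_cast (Real.exp_nat_mul _ 10).trans_le (pow_le_pow_left₀ (Real.exp_nonneg _) hdamp 10)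

theorem norm_dampedOuter_ofReal_mul (hA : 0 ≤ A) (hl : ∀ b ∈ l, 0 ≤ b) {x : ℝ} (hx : x ≠ 0) :
    ‖dampedOuter S c s A l x‖ * growthFactor (A / x ^ 2) l ^ 5
      = Real.exp (potential S c s x).re := by
  have hgrowth : ((l.map fun b => √(A * b)).map fun δ => 1 + δ ^ 2 / x ^ 2).prod
      = growthFactor (A / x ^ 2) l := by
    rw [growthFactor, List.map_map]
    congr 1
    refine List.map_congr_left fun b hb => ?_
    rw [Function.comp_apply, Real.sq_sqrt (mul_nonneg hA (hl b hb))]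
    ring
  have hdamp := norm_damp_ofReal_sq_mul hx (l.map fun b => √(A * b))
  rw [hgrowth] at hdamp
  rw [dampedOuter, norm_mul, Complex.norm_exp, norm_pow]
  linear_combination Real.exp (potential S c s x).re * congrArg (· ^ 5) hdamp

theorem norm_dampedOuter_le (hc : ∀ n ∈ S, 0 ≤ c n) (hs : ∀ n ∈ S, 0 < s n)
    (hA : 0 ≤ A) (hcA : 60 * ∑ n ∈ S, c n * s n ≤ A) (hlA : 20 * (l.map Real.sqrt).sum ≤ √A)
    {x ρ : ℝ} (hx : x ≠ 0) {ζ : ℂ} (hζ : ‖ζ - x‖ ≤ ρ) (hρ : ρ ≤ |x| / 20) :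
    ‖dampedOuter S c s A l ζ‖ ≤ ‖dampedOuter S c s A l x‖ * Real.exp (2 * A * ρ / x ^ 2) := by
  have hρ0 : 0 ≤ ρ := (norm_nonneg _).trans hζ
  have hexp := Real.exp_le_exp.2 (potential_re_le hc hs hx hζ hρ)
  have hdamp := norm_damp_le hx hζ hρ (l := l.map fun b => √(A * b))
    (List.forall_mem_map.2 fun b _ => Real.sqrt_nonneg _)
  rw [sum_map_sqrt_mul hA] at hdamp
  have hsum : 20 * (√A * (l.map Real.sqrt).sum) ≤ A := by
    nlinarith [Real.mul_self_sqrt hA, Real.sqrt_nonneg A]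
  have hadd : 60 * (∑ n ∈ S, c n * s n) * ρ / x ^ 2
      + (10 : ℕ) * (2 * (√A * (l.map Real.sqrt).sum) * ρ / x ^ 2) ≤ 2 * A * ρ / x ^ 2 := by
    rw [← mul_div_assoc, ← add_div]
    gcongr
    push_cast
    nlinarith
  rw [Real.exp_add] at hexp
  simp only [dampedOuter, norm_mul, Complex.norm_exp, norm_pow]
  calc _ ≤ (Real.exp (potential S c s x).re
          * Real.exp (60 * (∑ n ∈ S, c n * s n) * ρ / x ^ 2))
        * (‖damp (l.map fun b => √(A * b)) x‖
          * Real.exp (2 * (√A * (l.map Real.sqrt).sum) * ρ / x ^ 2)) ^ 10 := by gcongr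
    _ = Real.exp (potential S c s x).re * ‖damp (l.map fun b => √(A * b)) x‖ ^ 10
        * Real.exp (60 * (∑ n ∈ S, c n * s n) * ρ / x ^ 2
          + (10 : ℕ) * (2 * (√A * (l.map Real.sqrt).sum) * ρ / x ^ 2)) := by
      rw [Real.exp_add, Real.exp_nat_mul]; ring
    _ ≤ _ := by gcongr

theorem sq_add_sq_le_two_mul_norm {x : ℝ} (Y : ℝ) {ζ : ℂ} (hζ : ‖ζ - x‖ ≤ |x| / 20) :
    x ^ 2 + Y ^ 2 ≤ 2 * ‖ζ ^ 2 + (Y : ℂ) ^ 2‖ := by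
  have hre := (Complex.abs_re_le_norm _).trans hζ
  have him := (Complex.abs_im_le_norm _).trans hζ
  rw [Complex.sub_re, Complex.ofReal_re] at hre
  rw [Complex.sub_im, Complex.ofReal_im, sub_zero] at him
  have hre' : 19 / 20 * |x| ≤ |ζ.re| := by
    have := abs_sub_abs_le_abs_sub x ζ.re
    rw [abs_sub_comm] at this
    linarith
  have := sub_im_sq_le_norm_sq_add_sq Y ζ
  nlinarith [pow_le_pow_left₀ (by positivity) hre' 2, pow_le_pow_left₀ (abs_nonneg _) him 2,
    sq_abs x, sq_abs ζ.re, sq_abs ζ.im]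

theorem norm_dampedOuter_div_le (hc : ∀ n ∈ S, 0 ≤ c n) (hs : ∀ n ∈ S, 0 < s n)
    (hA : 0 < A) (hl : ∀ b ∈ l, 0 ≤ b) (hcA : 60 * ∑ n ∈ S, c n * s n ≤ A)
    (hlA : 20 * (l.map Real.sqrt).sum ≤ √A) (Y : ℝ) {x : ℝ} (hx : x ≠ 0) {ζ : ℂ}
    (hζ : ‖ζ - x‖ ≤ 2 * growthRadius (A / x ^ 2) l)
    (hρ : 2 * growthRadius (A / x ^ 2) l ≤ |x| / 20) :
    ‖dampedOuter S c s A l ζ / (ζ ^ 2 + (Y : ℂ) ^ 2)‖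
      ≤ 2 * (‖dampedOuter S c s A l x‖ * growthFactor (A / x ^ 2) l ^ 4) / (x ^ 2 + Y ^ 2) := by
  have hkernel := sq_add_sq_le_two_mul_norm Y (hζ.trans hρ)
  have hexp : Real.exp (2 * A * (2 * growthRadius (A / x ^ 2) l) / x ^ 2)
      ≤ growthFactor (A / x ^ 2) l ^ 4 := by
    refine le_of_eq_of_le ?_ (pow_le_pow_left₀ (Real.exp_nonneg _)
      (exp_mul_growthRadius_le (by positivity : 0 ≤ A / x ^ 2) hl) 4)
    rw [← Real.exp_nat_mul]
    congr 1
    push_cast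
    ring
  have hpos : 0 < x ^ 2 + Y ^ 2 := by positivity
  rw [norm_div, div_le_div_iff₀ (by linarith) hpos, mul_comm (2 : ℝ), mul_assoc]
  have := (Real.exp_nonneg _).trans hexp
  gcongr
  exact (norm_dampedOuter_le hc hs hA.le hcA hlA hx hζ hρ).trans (by gcongr)

theorem norm_diffProd_dampedOuter_div_le (hc : ∀ n ∈ S, 0 ≤ c n) (hs : ∀ n ∈ S, 0 < s n)
    (hA : 0 < A) (hl : ∀ b ∈ l, 0 < b) (hcA : 60 * ∑ n ∈ S, c n * s n ≤ A)
    (hlA : 20 * (l.map Real.sqrt).sum ≤ √A) (Y : ℝ) {x : ℝ} (hx : x ≠ 0) :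
    ‖diffProd l (fun z => dampedOuter S c s A l z / (z ^ 2 + (Y : ℂ) ^ 2)) x‖
      ≤ 4 * (Real.exp (potential S c s x).re / (x ^ 2 + Y ^ 2)) := by
  have hl' : ∀ b ∈ l, 0 ≤ b := fun b hb => (hl b hb).le
  have hx_abs := abs_pos.2 hx
  have hρ : 2 * growthRadius (A / x ^ 2) l ≤ |x| / 20 := by
    refine (two_mul_growthRadius_le (by positivity) hl').trans ?_
    rw [Real.sqrt_div hA.le, Real.sqrt_sq_eq_abs, div_div_eq_mul_div, div_le_iff₀ (by positivity)]
    nlinarith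
  have hball : ∀ ζ ∈ Metric.closedBall (x : ℂ) (2 * growthRadius (A / x ^ 2) l),
      ‖ζ - x‖ ≤ 2 * growthRadius (A / x ^ 2) l := fun ζ hζ => by rwa [← mem_closedBall_iff_norm]
  have hanalytic : ∀ ζ ∈ Metric.closedBall (x : ℂ) (2 * growthRadius (A / x ^ 2) l),
      AnalyticAt ℂ (fun z => dampedOuter S c s A l z / (z ^ 2 + (Y : ℂ) ^ 2)) ζ := fun ζ hζ => by
    have hζ := (hball ζ hζ).trans hρ
    have hre := (Complex.abs_re_le_norm _).trans hζ
    have him := (Complex.abs_im_le_norm _).trans hζ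
    rw [Complex.sub_re, Complex.ofReal_re, abs_sub_comm] at hre
    rw [Complex.sub_im, Complex.ofReal_im, sub_zero] at him
    have := abs_sub_abs_le_abs_sub x ζ.re
    refine (analyticAt_dampedOuter hs (by linarith)).fun_div (by fun_prop) (norm_pos_iff.1 ?_)
    have := sq_add_sq_le_two_mul_norm Y hζ
    have : 0 < x ^ 2 + Y ^ 2 := by positivity
    linarith
  refine (norm_diffProd_le (by positivity) hl hanalytic fun ζ hζ =>
    norm_dampedOuter_div_le hc hs hA hl' hcA hlA Y hx (hball ζ hζ) hρ).trans_eq ?_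
  rw [← norm_dampedOuter_ofReal_mul hA.le hl' hx]
  ring

end DampedOuter

/-! ### Exponential series in a weighted `L²` space -/

/- The Poisson kernel of the lower half-plane at `-i`; for this weight the inner products of the
exponentials are explicit. -/
local notation "κ" => ProbabilityTheory.cauchyMeasure 0 1

theorem cauchyMeasure_zero_one :
    κ = volume.withDensity fun x => ENNReal.ofReal (Real.pi⁻¹ * (1 / (x ^ 2 + 1))) := by
  rw [ProbabilityTheory.cauchyMeasure_of_scale_ne_zero 0 one_ne_zero]
  congr 1
  ext x
  simp [ProbabilityTheory.cauchyPDF_def, ProbabilityTheory.cauchyPDFReal_def]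

theorem integral_cauchyMeasure (f : ℝ → ℂ) :
    ∫ x, f x ∂κ = Real.pi⁻¹ * ∫ x : ℝ, f x / ((x : ℂ) ^ 2 + ((1 : ℝ) : ℂ) ^ 2) := by
  rw [cauchyMeasure_zero_one, integral_withDensity_eq_integral_toReal_smul (by fun_prop)
    (Eventually.of_forall fun _ => ENNReal.ofReal_lt_top), ← integral_const_mul]
  congr 1
  ext x
  rw [ENNReal.toReal_ofReal (by positivity), Complex.real_smul]
  push_cast
  ring

theorem cauchyMeasure_le_volume : κ ≤ volume := by
  conv_rhs => rw [← withDensity_one (μ := volume)]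
  rw [cauchyMeasure_zero_one]
  refine withDensity_mono (Eventually.of_forall fun x => ENNReal.ofReal_le_one.2 ?_)
  rw [inv_mul_eq_div, div_div, div_le_one (by positivity)]
  nlinarith [sq_nonneg x, Real.two_le_pi]

theorem volume_restrict_Icc_le (R : ℝ) :
    volume.restrict (Icc (-R) R) ≤ ENNReal.ofReal (Real.pi * (R ^ 2 + 1)) • κ := by
  rw [cauchyMeasure_zero_one, ← withDensity_smul _ (by fun_prop),
    ← withDensity_indicator_one measurableSet_Icc]
  refine withDensity_mono (Eventually.of_forall fun x => indicator_le (fun x hx => ?_) x)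
  rw [Pi.smul_apply, smul_eq_mul, ← ENNReal.ofReal_mul (by positivity), Pi.one_apply,
    ENNReal.one_le_ofReal, mul_mul_mul_comm, mul_inv_cancel₀ Real.pi_ne_zero, one_mul, mul_one_div,
    one_le_div (by positivity)]
  linarith [sq_le_sq' hx.1 hx.2]

theorem expo_add (α β t : ℝ) : expo (α + β) t = expo α t * expo β t := by
  rw [expo, expo, expo, ← Complex.exp_add]
  congr 1
  push_cast
  ring

theorem conj_expo (α t : ℝ) : (starRingEnd ℂ) (expo α t) = expo (-α) t := by
  rw [expo, expo, ← Complex.exp_conj]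
  congr 1
  simp only [map_mul, Complex.conj_ofReal, Complex.conj_I, map_ofNat]
  push_cast
  ring

theorem expo_neg_right (α t : ℝ) : expo α (-t) = expo (-α) t := by
  rw [expo, expo]
  congr 1
  push_cast
  ring

theorem integral_expo_cauchyMeasure (ξ : ℝ) :
    ∫ x, expo ξ x ∂κ = Real.exp (-(2 * Real.pi) * |ξ|) := by
  have hnonpos : ∀ μ ≤ 0, ∫ x : ℝ, expo μ x / ((x : ℂ) ^ 2 + ((1 : ℝ) : ℂ) ^ 2)
      = Real.pi * Real.exp (-(2 * Real.pi) * |μ|) := fun μ hμ => by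
    have hpoisson := (BddHalfPlane.const 1).integral_expo_mul_div one_pos hμ
    simp only [mul_one_div] at hpoisson
    rw [hpoisson, abs_of_nonpos hμ, mul_one, Complex.ofReal_one, div_one, mul_one, neg_mul_neg]
  have hpi : (Real.pi : ℂ) ≠ 0 := by exact_mod_cast Real.pi_ne_zero
  have hcancel : ∀ v : ℂ, ((Real.pi⁻¹ : ℝ) : ℂ) * (Real.pi * v) = v := fun v => by
    rw [Complex.ofReal_inv, inv_mul_cancel_left₀ hpi]
  rw [integral_cauchyMeasure]
  rcases le_total ξ 0 with hξ | hξ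
  · rw [hnonpos ξ hξ, hcancel]
  · rw [← integral_neg_eq_self]
    simp only [expo_neg_right, Complex.ofReal_neg, neg_sq]
    rw [hnonpos (-ξ) (neg_nonpos.2 hξ), hcancel, abs_neg]

theorem memLp_expo (α : ℝ) : MemLp (expo α) 2 κ :=
  .of_bound (continuous_expo α).aestronglyMeasurable 1
    (Eventually.of_forall fun t => (norm_expo α t).le)

/-- `e^{2πiαt}` as a vector of `L²` of the Cauchy distribution. -/
noncomputable def expoLp (α : ℝ) : Lp ℂ 2 κ :=
  (memLp_expo α).toLp

theorem inner_expoLp (α β : ℝ) :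
    inner ℂ (expoLp α) (expoLp β) = ((Real.exp (-(2 * Real.pi) * |α - β|) : ℝ) : ℂ) := by
  rw [L2.inner_def, abs_sub_comm, ← integral_expo_cauchyMeasure]
  refine integral_congr_ae ?_
  filter_upwards [(memLp_expo α).coeFn_toLp, (memLp_expo β).coeFn_toLp] with t hα hβ
  rw [expoLp, expoLp, hα, hβ, RCLike.inner_apply, conj_expo, ← expo_add, ← sub_eq_add_neg]

theorem norm_sum_smul_sq_le_of_schur {ι E : Type*} [NormedAddCommGroup E] [InnerProductSpace ℂ E]
    {v : ι → E} {m : ι → ι → ℝ} (hm : ∀ i j, ‖(inner ℂ (v i) (v j) : ℂ)‖ ≤ m i j)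
    (hsymm : ∀ i j, m i j = m j i) {K : ℝ} {p : Finset ι} (hK : ∀ i, ∑ j ∈ p, m i j ≤ K)
    (a : ι → ℂ) : ‖∑ i ∈ p, a i • v i‖ ^ 2 ≤ K * ∑ i ∈ p, ‖a i‖ ^ 2 := by
  have hexpand : ‖(inner ℂ (∑ i ∈ p, a i • v i) (∑ i ∈ p, a i • v i) : ℂ)‖
      ≤ ∑ i ∈ p, ∑ j ∈ p, ‖a i‖ * ‖a j‖ * m i j := by
    rw [sum_inner]
    refine norm_sum_le_of_le _ fun i _ => ?_
    rw [inner_sum]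
    refine norm_sum_le_of_le _ fun j _ => ?_
    rw [inner_smul_left, inner_smul_right, norm_mul, norm_mul, RCLike.norm_conj, ← mul_assoc]
    exact mul_le_mul_of_nonneg_left (hm i j) (by positivity)
  have hswap : ∑ i ∈ p, ∑ j ∈ p, ‖a j‖ ^ 2 * m i j = ∑ i ∈ p, ∑ j ∈ p, ‖a i‖ ^ 2 * m i j := by
    rw [Finset.sum_comm]
    simp only [hsymm]
  calc ‖∑ i ∈ p, a i • v i‖ ^ 2
      = ‖(inner ℂ (∑ i ∈ p, a i • v i) (∑ i ∈ p, a i • v i) : ℂ)‖ := by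
        rw [inner_self_eq_norm_sq_to_K]; simp
    _ ≤ ∑ i ∈ p, ∑ j ∈ p, (‖a i‖ ^ 2 * m i j + ‖a j‖ ^ 2 * m i j) / 2 := by
        refine hexpand.trans (Finset.sum_le_sum fun i _ => Finset.sum_le_sum fun j _ => ?_)
        nlinarith [mul_nonneg ((norm_nonneg _).trans (hm i j)) (sq_nonneg (‖a i‖ - ‖a j‖))]
    _ = ∑ i ∈ p, ‖a i‖ ^ 2 * ∑ j ∈ p, m i j := by
        simp only [← Finset.sum_div, Finset.sum_add_distrib, hswap, add_self_div_two,
          ← Finset.mul_sum]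
    _ ≤ K * ∑ i ∈ p, ‖a i‖ ^ 2 := by
        rw [Finset.mul_sum]
        exact Finset.sum_le_sum fun i _ => by
          rw [mul_comm]; exact mul_le_mul_of_nonneg_right (hK i) (sq_nonneg _)

theorem summable_smul_of_norm_sum_sq_le {ι E : Type*} [NormedAddCommGroup E] [NormedSpace ℂ E]
    [CompleteSpace E] {v : ι → E} {a : ι → ℂ} {K : ℝ} (ha : Memℓp a 2)
    (h : ∀ p : Finset ι, ‖∑ i ∈ p, a i • v i‖ ^ 2 ≤ K * ∑ i ∈ p, ‖a i‖ ^ 2) :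
    Summable fun i => a i • v i := by
  have hsq : Summable fun i => ‖a i‖ ^ 2 := by
    simpa using (memℓp_gen_iff (by norm_num)).1 ha
  rw [summable_iff_vanishing_norm] at hsq ⊢
  intro ε hε
  obtain ⟨s, hs⟩ := hsq (ε ^ 2 / (|K| + 1)) (by positivity)
  refine ⟨s, fun t ht => lt_of_pow_lt_pow_left₀ 2 hε.le ((h t).trans_lt ?_)⟩
  have htail := hs t ht
  have hnonneg : 0 ≤ ∑ i ∈ t, ‖a i‖ ^ 2 := by positivity
  rw [Real.norm_of_nonneg hnonneg, lt_div_iff₀ (by positivity)] at htail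
  nlinarith [mul_le_mul_of_nonneg_right (le_abs_self K) hnonneg]

theorem summable_exp_neg_mul_abs_int {c : ℝ} (hc : 0 < c) :
    Summable fun n : ℤ => Real.exp (-(c * |(n : ℝ)|)) := by
  have hnat : Summable fun n : ℕ => Real.exp (-(c * n)) :=
    (Real.summable_exp_nat_mul_iff.2 (neg_neg_of_pos hc)).congr fun n => by ring_nf
  exact .of_nat_of_neg (by simpa using hnat) (by simpa using hnat)

theorem abs_floor_le (x : ℝ) : |(⌊x⌋ : ℝ)| ≤ |x| + 1 := by
  have hfract : |(⌊x⌋ : ℝ) - x| ≤ 1 :=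
    abs_le.2 ⟨by linarith [Int.lt_floor_add_one x], by linarith [Int.floor_le x]⟩
  linarith [abs_sub_abs_le_abs_sub (⌊x⌋ : ℝ) x]

theorem UniformlyDiscrete.exists_sum_exp_le {S : Set ℝ} (hS : UniformlyDiscrete S) {c : ℝ}
    (hc : 0 < c) :
    ∃ K : ℝ, ∀ (x : ℝ) (p : Finset S), ∑ j ∈ p, Real.exp (-c * |x - j|) ≤ K := by
  obtain ⟨δ, hδ, hsep⟩ := hS
  refine ⟨Real.exp (c * δ) * ∑' n : ℤ, Real.exp (-(c * δ * |(n : ℝ)|)), fun x p => ?_⟩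
  have hinj : Function.Injective fun j : S => ⌊((j : ℝ) - x) / δ⌋ := fun i j hij => by
    by_contra hne
    have hlt := Int.abs_sub_lt_one_of_floor_eq_floor hij
    rw [← sub_div, sub_sub_sub_cancel_right, abs_div, abs_of_pos hδ, div_lt_one hδ] at hlt
    exact (hsep i i.2 j j.2 fun h => hne (Subtype.ext h)).not_gt hlt
  have hterm : ∀ j : S, Real.exp (-c * |x - j|)
      ≤ Real.exp (c * δ) * Real.exp (-(c * δ * |(⌊((j : ℝ) - x) / δ⌋ : ℝ)|)) := fun j => by
    rw [← Real.exp_add]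
    have hfloor := abs_floor_le (((j : ℝ) - x) / δ)
    rw [abs_div, abs_of_pos hδ, abs_sub_comm, div_add_one hδ.ne', le_div_iff₀ hδ] at hfloor
    exact Real.exp_le_exp.2 (by nlinarith)
  calc ∑ j ∈ p, Real.exp (-c * |x - j|)
      ≤ Real.exp (c * δ) * ∑ j ∈ p, Real.exp (-(c * δ * |(⌊((j : ℝ) - x) / δ⌋ : ℝ)|)) := by
        rw [Finset.mul_sum]
        exact Finset.sum_le_sum fun j _ => hterm j
    _ = Real.exp (c * δ) * ∑ n ∈ p.map ⟨_, hinj⟩, Real.exp (-(c * δ * |(n : ℝ)|)) := by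
        rw [Finset.sum_map, Function.Embedding.coeFn_mk]
    _ ≤ _ := by
        gcongr
        exact (summable_exp_neg_mul_abs_int (mul_pos hc hδ)).sum_le_tsum _
          fun n _ => Real.exp_nonneg _

theorem UniformlyDiscrete.summable_smul_expoLp {S : Set ℝ} (hS : UniformlyDiscrete S) {a : S → ℂ}
    (ha : Memℓp a 2) : Summable fun j : S => a j • expoLp j := by
  obtain ⟨K, hK⟩ := hS.exists_sum_exp_le (c := 2 * Real.pi) (by positivity)
  refine summable_smul_of_norm_sum_sq_le ha fun p => norm_sum_smul_sq_le_of_schur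
    (v := fun j : S => expoLp j) (m := fun i j : S => Real.exp (-(2 * Real.pi) * |(i : ℝ) - j|))
    (fun i j => ?_) (fun i j => ?_) (fun i => hK i p) a
  · rw [inner_expoLp, Complex.norm_of_nonneg (Real.exp_nonneg _)]
  · rw [abs_sub_comm]

/-- The finite exponential sum `∑_{i ∈ p} a_i e^{2πiφ_i t}`. -/
noncomputable def expoSum {ι : Type*} (φ : ι → ℝ) (a : ι → ℂ) (p : Finset ι) (t : ℝ) : ℂ :=
  ∑ i ∈ p, a i * expo (φ i) t

/-- `H = ∑ a_i e^{2πiφ_i t}`, unconditionally in `L²` of the Cauchy distribution. Its density is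
bounded below on every bounded interval, so this implies `L²` convergence there. -/
structure HasExpoSum {ι : Type*} (φ : ι → ℝ) (a : ι → ℂ) (H : ℝ → ℂ) : Prop where
  memLp : MemLp H 2 κ
  tendsto : Tendsto (fun p => eLpNorm (fun t => H t - expoSum φ a p t) 2 κ) atTop (𝓝 0)

section ExpoSum

variable {ι : Type*} {φ : ι → ℝ} {a : ι → ℂ}

theorem continuous_expoSum (p : Finset ι) : Continuous (expoSum φ a p) :=
  continuous_finsetSum p fun i _ => (continuous_expo (φ i)).const_mul (a i)

theorem coeFn_sum_smul_expoLp (p : Finset ι) :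
    ⇑(∑ i ∈ p, a i • expoLp (φ i)) =ᵐ[κ] expoSum φ a p := by
  classical
  unfold expoSum
  induction p using Finset.induction_on with
  | empty => exact Lp.coeFn_zero ℂ 2 κ
  | insert i p hi ih =>
    simp only [Finset.sum_insert hi]
    filter_upwards [ih, Lp.coeFn_add (a i • expoLp (φ i)) (∑ j ∈ p, a j • expoLp (φ j)),
      Lp.coeFn_smul (a i) (expoLp (φ i)), (memLp_expo (φ i)).coeFn_toLp] with t hp hadd hsmul hi
    rw [hadd, Pi.add_apply, hp, hsmul, Pi.smul_apply, smul_eq_mul, expoLp, hi]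

theorem exists_hasExpoSum (h : Summable fun i => a i • expoLp (φ i)) :
    ∃ H : ℝ → ℂ, StronglyMeasurable H ∧ HasExpoSum φ a H := by
  refine ⟨⇑(∑' i, a i • expoLp (φ i)), Lp.stronglyMeasurable _, Lp.memLp _, ?_⟩
  have hsum : Tendsto (fun p => ∑ i ∈ p, a i • expoLp (φ i)) atTop
    (𝓝 (∑' i, a i • expoLp (φ i))) := h.hasSum
  refine ((Lp.tendsto_Lp_iff_tendsto_eLpNorm' _ _).1 hsum).congr fun p => ?_
  rw [eLpNorm_sub_comm]
  exact eLpNorm_congr_ae (.sub .rfl (coeFn_sum_smul_expoLp p))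

theorem HasExpoSum.translate {H : ℝ → ℂ} (h : HasExpoSum φ a H) (ν : ℝ) :
    HasExpoSum (fun i => φ i - ν) a fun t => H t * expo (-ν) t := by
  have hnorm : ∀ (z : ℂ) t, ‖z * expo (-ν) t‖ = ‖z‖ := fun z t => by
    rw [norm_mul, norm_expo, mul_one]
  refine ⟨h.memLp.congr_norm (h.memLp.1.mul (continuous_expo _).aestronglyMeasurable)
    (Eventually.of_forall fun t => (hnorm _ t).symm), h.tendsto.congr fun p => ?_⟩
  refine eLpNorm_congr_norm_ae (Eventually.of_forall fun t => ?_)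
  simp only [expoSum, sub_eq_add_neg _ ν, expo_add, ← mul_assoc, ← Finset.sum_mul, ← sub_mul, hnorm]

end ExpoSum

/-- The points of `L` and of `G` as a single family of frequencies. -/
def freq (L G : Set ℝ) : L ⊕ G → ℝ :=
  Sum.elim (↑) (↑)

section Series

variable {L G : Set ℝ} {a : L → ℂ} {b : G → ℂ}

theorem partialSum_eq_expoSum (p : Finset L × Finset G) :
    partialSum a b p = expoSum (freq L G) (Sum.elim a b) (p.1.disjSum p.2) := by
  ext t
  simp only [partialSum, expoSum, freq, Finset.sum_disjSum, Sum.elim_inl, Sum.elim_inr]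

theorem HasExpoSum.isNonharmonicSeries {H : ℝ → ℂ} (hH : AEStronglyMeasurable H volume)
    (h : HasExpoSum (freq L G) (Sum.elim a b) H) : IsNonharmonicSeries a b H := by
  have hlim := h.tendsto.comp (Finset.sumEquiv (α := L) (β := G)).symm.tendsto_atTop
  refine ⟨hH, fun R => ?_⟩
  set C := ENNReal.ofReal (Real.pi * (R ^ 2 + 1)) ^ (1 / (2 : ℝ≥0∞)).toReal
  have hbound := ENNReal.Tendsto.const_mul (a := C) hlim
    (Or.inr (ENNReal.rpow_ne_top_of_nonneg (by positivity) ENNReal.ofReal_ne_top))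
  rw [mul_zero] at hbound
  refine tendsto_of_tendsto_of_tendsto_of_le_of_le tendsto_const_nhds hbound (fun _ => zero_le)
    fun p => (eLpNorm_mono_measure _ (volume_restrict_Icc_le R)).trans_eq ?_
  rw [eLpNorm_smul_measure_of_ne_top (by norm_num), partialSum_eq_expoSum, smul_eq_mul]
  rfl

theorem IsNonharmonicSeries.ae_eq {H H' : ℝ → ℂ} (h : IsNonharmonicSeries a b H)
    (h' : IsNonharmonicSeries a b H') : H =ᵐ[volume] H' := by
  have hrestrict : ∀ R : ℝ, H =ᵐ[volume.restrict (Icc (-R) R)] H' := fun R => by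
    have hmeas : ∀ {F : ℝ → ℂ}, AEStronglyMeasurable F volume → ∀ p, AEStronglyMeasurable
        (fun t => F t - partialSum a b p t) (volume.restrict (Icc (-R) R)) := fun hF p => by
      rw [partialSum_eq_expoSum]
      exact hF.restrict.sub (continuous_expoSum _).aestronglyMeasurable
    have hsum := (h.2 R).add (h'.2 R)
    rw [add_zero] at hsum
    have hzero : eLpNorm (H - H') 2 (volume.restrict (Icc (-R) R)) = 0 := by
      refine le_antisymm (ge_of_tendsto' hsum fun p => ?_) zero_le
      refine le_of_eq_of_le ?_ (eLpNorm_sub_le (hmeas h.1 p) (hmeas h'.1 p) (by norm_num))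
      congr 1
      ext t
      simp only [Pi.sub_apply, sub_sub_sub_cancel_right]
    have hae := (eLpNorm_eq_zero_iff (h.1.restrict.sub h'.1.restrict) (by norm_num)).1 hzero
    exact hae.mono fun t ht => sub_eq_zero.1 ht
  have hcover : ⋃ n : ℕ, Icc (-(n : ℝ)) n = univ := eq_univ_of_forall fun x =>
    mem_iUnion.2 ((exists_nat_ge |x|).imp fun n hn => abs_le.1 hn)
  rw [← Measure.restrict_univ (μ := volume), ← hcover]
  exact (ae_eq_restrict_iUnion_iff _ _ _).2 fun n => hrestrict n

end Series

theorem UniformlyDiscrete.summable_exp_neg_abs_sub {S : Set ℝ} (hS : UniformlyDiscrete S) (ν : ℝ) :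
    Summable fun j : S => Real.exp (-|(j : ℝ) - ν|) := by
  obtain ⟨K, hK⟩ := hS.exists_sum_exp_le one_pos
  refine summable_of_sum_le (c := K) (fun _ => Real.exp_nonneg _) fun p => ?_
  simpa only [abs_sub_comm ν, neg_one_mul] using hK ν p

theorem UniformlyDiscrete.summable_norm_mul_exp_neg_abs_sub {S : Set ℝ} (hS : UniformlyDiscrete S)
    {a : S → ℂ} (ha : Memℓp a 2) (ν : ℝ) :
    Summable fun j : S => ‖a j‖ * Real.exp (-|(j : ℝ) - ν|) := by
  have hbound : ∀ j, ‖a j‖ ≤ ‖(⟨a, ha⟩ : lp (fun _ : S => ℂ) 2)‖ :=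
    lp.norm_apply_le_norm two_ne_zero ⟨a, ha⟩
  exact .of_nonneg_of_le (fun j => by positivity)
    (fun j => mul_le_mul_of_nonneg_right (hbound j) (Real.exp_nonneg _))
    ((hS.summable_exp_neg_abs_sub ν).mul_left _)

theorem UniformlyDiscrete.summable_one_div_sqrt_sub_of_bddAbove {S : Set ℝ}
    (hS : UniformlyDiscrete S) (hbdd : BddAbove S) (ν : ℝ) :
    Summable fun j : S => 1 / √((j : ℝ) - ν) := by
  obtain ⟨B, hB⟩ := hbdd
  have hlarge : ∀ᶠ j : S in cofinite, Real.exp (-|(j : ℝ) - ν|) < Real.exp (-|B - ν|) :=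
    (hS.summable_exp_neg_abs_sub ν).tendsto_cofinite_zero.eventually_lt_const (Real.exp_pos _)
  refine .of_norm_bounded_eventually (g := 0) summable_zero (hlarge.mono fun j hj => ?_)
  have hjB : (j : ℝ) ≤ B := hB j.2
  have hle : (j : ℝ) - ν ≤ 0 := by
    by_contra! hpos
    rw [Real.exp_lt_exp, neg_lt_neg_iff, abs_of_pos hpos] at hj
    linarith [le_abs_self (B - ν)]
  rw [Real.sqrt_eq_zero_of_nonpos hle, div_zero, norm_zero, Pi.zero_apply]

theorem summable_one_div_sqrt_sub {ι : Type*} {φ : ι → ℝ} (hφ : ∀ i, 0 < φ i)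
    (h : Summable fun i => 1 / √(φ i)) (ν : ℝ) : Summable fun i => 1 / √(φ i - ν) := by
  have hlarge : ∀ᶠ i in cofinite, 1 / √(φ i) < 1 / √(2 * |ν| + 1) :=
    h.tendsto_cofinite_zero.eventually_lt_const (by positivity)
  refine .of_norm_bounded_eventually (h.mul_left √2) (hlarge.mono fun i hi => ?_)
  rw [one_div_lt_one_div (Real.sqrt_pos.2 (hφ i)) (by positivity),
    Real.sqrt_lt_sqrt_iff (by positivity)] at hi
  have hpos : 0 < φ i / 2 := half_pos (hφ i)
  calc ‖1 / √(φ i - ν)‖ = 1 / √(φ i - ν) := Real.norm_of_nonneg (by positivity)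
    _ ≤ 1 / √(φ i / 2) := by
        gcongr
        linarith [le_abs_self ν]
    _ = √2 * (1 / √(φ i)) := by rw [Real.sqrt_div (hφ i).le, one_div_div, mul_one_div]

/-! ### Dyadic potentials -/

/-- The dyadic points `1/2, 1/4, 1/8, …`. -/
noncomputable def dyad (n : ℕ) : ℝ :=
  (1 / 2) ^ (n + 1)

theorem dyad_pos (n : ℕ) : 0 < dyad n := by
  unfold dyad
  positivity

theorem dyad_antitone : Antitone dyad := fun _ _ h =>
  pow_le_pow_of_le_one (by norm_num) (by norm_num) (by gcongr)

theorem dyad_succ (n : ℕ) : dyad (n + 1) = dyad n / 2 := by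
  rw [dyad, pow_succ, ← dyad, mul_one_div]

theorem dyad_lt_one (n : ℕ) : dyad n < 1 :=
  pow_lt_one₀ (by norm_num) (by norm_num) n.succ_ne_zero

theorem exists_dyad_le {x : ℝ} (hx : 0 < x) : ∃ N, dyad N ≤ x := by
  obtain ⟨N, hN⟩ := exists_pow_lt_of_lt_one hx (by norm_num : (1 / 2 : ℝ) < 1)
  exact ⟨N, (pow_le_pow_of_le_one (by norm_num) (by norm_num) N.le_succ).trans hN.le⟩

/-- The increment of `u` between consecutive dyadic points. -/
noncomputable def dyadicStep (u : ℝ → ℝ) (n : ℕ) : ℝ :=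
  u (dyad (n + 1)) - u (dyad n)

/-- The `potential` whose `n`-th bump, `n < N`, has its positive part on `(0, 2^{-n-2})` and height
proportional to `dyadicStep u n`. As `re bump ≤ 8 / 3` on the line, the factor `3 / 16` keeps twice
the real part below the positive part of `u - u (1 / 2)` on `(0, 1)`. -/
noncomputable def dyadicPotential (u : ℝ → ℝ) (N : ℕ) : ℂ → ℂ :=
  potential (Finset.range N) (fun n => 3 / 16 * dyadicStep u n) (fun n => dyad (n + 1) / 4)

theorem sum_dyadicPotential_coeff_mul_scale (u : ℝ → ℝ) (N : ℕ) :
    ∑ n ∈ Finset.range N, 3 / 16 * dyadicStep u n * (dyad (n + 1) / 4)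
      = 3 / 128 * ∑ n ∈ Finset.range N, dyadicStep u n * dyad n := by
  rw [Finset.mul_sum]
  refine Finset.sum_congr rfl fun n _ => ?_
  rw [dyad_succ]
  ring

section Antitone

variable {u : ℝ → ℝ} (hu : AntitoneOn u (Ioo 0 1))
include hu

theorem dyadicStep_nonneg (n : ℕ) : 0 ≤ dyadicStep u n :=
  sub_nonneg.2 (hu ⟨dyad_pos _, dyad_lt_one _⟩ ⟨dyad_pos _, dyad_lt_one _⟩
    (dyad_antitone n.le_succ))

theorem antitoneOn_max_dyad_mono {x : ℝ} (hx : x ∈ Ioo (0 : ℝ) 1) :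
    Monotone fun n => u (max x (dyad n)) := fun _ _ hmn =>
  hu ⟨lt_max_of_lt_left hx.1, max_lt hx.2 (dyad_lt_one _)⟩
    ⟨lt_max_of_lt_left hx.1, max_lt hx.2 (dyad_lt_one _)⟩ (max_le_max_left x (dyad_antitone hmn))

theorem le_add_sum_dyadicStep {x : ℝ} (hx : x ∈ Ioo (0 : ℝ) 1) {N : ℕ} (hN : dyad N ≤ x) :
    u x ≤ u (dyad 0) + ∑ n ∈ Finset.range N,
      (Iio (dyad n)).indicator (fun _ => dyadicStep u n) x := by
  have hstep : ∀ n, u (max x (dyad (n + 1))) - u (max x (dyad n))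
      ≤ (Iio (dyad n)).indicator (fun _ => dyadicStep u n) x := fun n => by
    rcases lt_or_ge x (dyad n) with h | h
    · rw [indicator_of_mem (mem_Iio.2 h), dyadicStep, max_eq_right h.le]
      exact sub_le_sub_right (hu ⟨dyad_pos _, dyad_lt_one _⟩
        ⟨lt_max_of_lt_left hx.1, max_lt hx.2 (dyad_lt_one _)⟩ (le_max_right _ _)) _
    · rw [indicator_of_notMem (notMem_Iio.2 h), max_eq_left h,
        max_eq_left ((dyad_antitone n.le_succ).trans h), sub_self]
  have htelescope := Finset.sum_range_sub (fun n => u (max x (dyad n))) N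
  rw [max_eq_left hN] at htelescope
  have hstart : u (max x (dyad 0)) ≤ u (dyad 0) := hu ⟨dyad_pos _, dyad_lt_one _⟩
    ⟨lt_max_of_lt_left hx.1, max_lt hx.2 (dyad_lt_one _)⟩ (le_max_right _ _)
  linarith [Finset.sum_le_sum fun n (_ : n ∈ Finset.range N) => hstep n]

theorem sum_dyadicStep_le {x : ℝ} (hx : x ∈ Ioo (0 : ℝ) 1) (N : ℕ) :
    ∑ n ∈ Finset.range N, (Iio (dyad (n + 1))).indicator (fun _ => dyadicStep u n) x
      ≤ max 0 (u x - u (dyad 0)) := by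
  have hmono := antitoneOn_max_dyad_mono hu hx
  have hstep : ∀ n, (Iio (dyad (n + 1))).indicator (fun _ => dyadicStep u n) x
      ≤ u (max x (dyad (n + 1))) - u (max x (dyad n)) := fun n => by
    rcases lt_or_ge x (dyad (n + 1)) with h | h
    · rw [indicator_of_mem (mem_Iio.2 h), dyadicStep, max_eq_right h.le,
        max_eq_right (h.trans_le (dyad_antitone n.le_succ)).le]
    · rw [indicator_of_notMem (notMem_Iio.2 h)]
      exact sub_nonneg.2 (hmono n.le_succ)
  calc ∑ n ∈ Finset.range N, (Iio (dyad (n + 1))).indicator (fun _ => dyadicStep u n) x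
      ≤ ∑ n ∈ Finset.range N, (u (max x (dyad (n + 1))) - u (max x (dyad n))) :=
        Finset.sum_le_sum fun n _ => hstep n
    _ = u (max x (dyad N)) - u (max x (dyad 0)) :=
        Finset.sum_range_sub (fun n => u (max x (dyad n))) N
    _ ≤ u x - u (max x (dyad 0)) := sub_le_sub_right (hu hx
        ⟨lt_max_of_lt_left hx.1, max_lt hx.2 (dyad_lt_one _)⟩ (le_max_left _ _)) _
    _ ≤ max 0 (u x - u (dyad 0)) := by
        rcases le_total x (dyad 0) with h | h
        · rw [max_eq_right h]
          exact le_max_right _ _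
        · rw [max_eq_left h, sub_self]
          exact le_max_left _ _

theorem ofReal_le_add_tsum_dyadicStep {x : ℝ} (hx : x ∈ Ioo (0 : ℝ) 1) :
    ENNReal.ofReal (u x) ≤ ENNReal.ofReal (u (dyad 0))
      + ∑' n, (Iio (dyad n)).indicator (fun _ => ENNReal.ofReal (dyadicStep u n)) x := by
  obtain ⟨N, hN⟩ := exists_dyad_le hx.1
  refine (ENNReal.ofReal_le_ofReal (le_add_sum_dyadicStep hu hx hN)).trans
    (ENNReal.ofReal_add_le.trans ?_)
  rw [ENNReal.ofReal_sum_of_nonneg fun n _ =>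
    indicator_nonneg (fun _ _ => dyadicStep_nonneg hu n) x]
  gcongr
  refine (Finset.sum_congr rfl fun n _ => ?_).trans_le (ENNReal.sum_le_tsum (Finset.range N))
  exact (indicator_comp_of_zero (g := ENNReal.ofReal) ENNReal.ofReal_zero ▸ rfl)

theorem exists_le_sum_dyadicStep_mul_dyad
    (hinf : ∫⁻ x in Ioo (0 : ℝ) 1, ENNReal.ofReal (u x) = ∞) (B : ℝ) :
    ∃ N, B ≤ ∑ n ∈ Finset.range N, dyadicStep u n * dyad n := by
  by_contra! hB
  have hnonneg : ∀ n, 0 ≤ dyadicStep u n * dyad n := fun n =>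
    mul_nonneg (dyadicStep_nonneg hu n) (dyad_pos n).le
  have hsummable : Summable fun n => dyadicStep u n * dyad n :=
    summable_of_sum_range_le hnonneg fun N => (hB N).le
  have hjump : ∀ n, ∫⁻ x in Ioo (0 : ℝ) 1,
      (Iio (dyad n)).indicator (fun _ => ENNReal.ofReal (dyadicStep u n)) x
        ≤ ENNReal.ofReal (dyadicStep u n * dyad n) := fun n => by
    rw [lintegral_indicator_const measurableSet_Iio, Measure.restrict_apply measurableSet_Iio,
      ENNReal.ofReal_mul (dyadicStep_nonneg hu n)]
    gcongr
    refine (measure_mono fun x hx => ⟨hx.2.1, hx.1⟩ :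
      _ ≤ volume (Ioo 0 (dyad n))).trans_eq ?_
    rw [Real.volume_Ioo, sub_zero]
  refine hinf.not_lt ((setLIntegral_mono' measurableSet_Ioo fun x hx =>
    ofReal_le_add_tsum_dyadicStep hu hx).trans_lt ?_)
  rw [lintegral_add_left measurable_const, lintegral_tsum fun n =>
      (measurable_const.indicator measurableSet_Iio).aemeasurable,
    setLIntegral_const, Real.volume_Ioo, ENNReal.add_lt_top]
  refine ⟨ENNReal.mul_lt_top ENNReal.ofReal_lt_top ENNReal.ofReal_lt_top,
    (ENNReal.tsum_le_tsum hjump).trans_lt ?_⟩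
  rw [← ENNReal.ofReal_tsum_of_nonneg hnonneg hsummable]
  exact ENNReal.ofReal_lt_top

theorem dyadicPotential_re_nonpos {x : ℝ} (hx : x ∉ Ioo (0 : ℝ) 1) (N : ℕ) :
    (dyadicPotential u N x).re ≤ 0 := by
  rw [dyadicPotential, potential_re]
  refine Finset.sum_nonpos fun n _ => mul_nonpos_of_nonneg_of_nonpos
    (mul_nonneg (by norm_num) (dyadicStep_nonneg hu n)) ?_
  rw [← Complex.ofReal_div]
  have hpos := dyad_pos (n + 1)
  refine bump_re_nonpos ((le_or_gt x 0).imp (fun h => ?_) fun h => ?_)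
  · exact div_nonpos_of_nonpos_of_nonneg h (by positivity)
  · have hx1 : 1 ≤ x := not_lt.1 fun h1 => hx ⟨h, h1⟩
    rw [le_div_iff₀ (by positivity)]
    linarith [dyad_lt_one (n + 1)]

theorem two_mul_dyadicPotential_re_le {x : ℝ} (hx : x ∈ Ioo (0 : ℝ) 1) (N : ℕ) :
    2 * (dyadicPotential u N x).re ≤ max 0 (u x - u (dyad 0)) := by
  refine le_trans ?_ (sum_dyadicStep_le hu hx N)
  rw [dyadicPotential, potential_re, Finset.mul_sum]
  refine Finset.sum_le_sum fun n _ => ?_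
  have hstep := dyadicStep_nonneg hu n
  have hpos := dyad_pos (n + 1)
  rw [← Complex.ofReal_div]
  by_cases hn : x < dyad (n + 1)
  · rw [indicator_of_mem (mem_Iio.2 hn)]
    nlinarith [mul_le_mul_of_nonneg_left (bump_re_le (x / (dyad (n + 1) / 4))) hstep]
  · rw [indicator_of_notMem (mt mem_Iio.1 hn)]
    have hbump : (bump ↑(x / (dyad (n + 1) / 4))).re ≤ 0 := bump_re_nonpos (Or.inr (by
      rw [le_div_iff₀ (by positivity)]
      linarith [not_lt.1 hn]))
    exact mul_nonpos_of_nonneg_of_nonpos two_pos.le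
      (mul_nonpos_of_nonneg_of_nonpos (by positivity) hbump)

theorem exp_dyadicPotential_re_sq_le (x : ℝ) (N : ℕ) :
    ENNReal.ofReal (Real.exp (dyadicPotential u N x).re) ^ 2
      ≤ 1 + (Ioo 0 1).indicator (fun x => ENNReal.ofReal (Real.exp (u x - u (dyad 0)))) x := by
  rw [← ENNReal.ofReal_pow (Real.exp_nonneg _), ← Real.exp_nat_mul, Nat.cast_two]
  by_cases hx : x ∈ Ioo (0 : ℝ) 1
  · rw [indicator_of_mem hx, ← ENNReal.ofReal_one,
      ← ENNReal.ofReal_add zero_le_one (Real.exp_nonneg _)]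
    refine ENNReal.ofReal_le_ofReal
      ((Real.exp_le_exp.2 (two_mul_dyadicPotential_re_le hu hx N)).trans ?_)
    rw [Real.exp_monotone.map_max, Real.exp_zero]
    exact max_le_add_of_nonneg zero_le_one (Real.exp_nonneg _)
  · rw [indicator_of_notMem hx, add_zero, ENNReal.ofReal_le_one, Real.exp_le_one_iff]
    linarith [dyadicPotential_re_nonpos hu hx N]

theorem lintegral_enorm_mul_exp_dyadicPotential_le {H : ℝ → ℂ} (hH : MemLp H 2 κ) (N : ℕ) :
    ∫⁻ x, ‖H x‖ₑ * ENNReal.ofReal (Real.exp (dyadicPotential u N x).re) ∂κ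
      ≤ 1 + ∫⁻ x, ‖H x‖ₑ ^ 2 ∂κ
        + ENNReal.ofReal (Real.exp (-u (dyad 0)))
          * ∫⁻ x in Ioo (0 : ℝ) 1, ‖H x‖ₑ ^ 2 * ENNReal.ofReal (Real.exp (u x)) := by
  have hle_sq : ∀ v : ℝ≥0∞, v ≤ 1 + v ^ 2 := fun v => by
    rcases le_total v 1 with hv | hv
    · exact hv.trans le_self_add
    · exact (le_self_pow hv two_ne_zero).trans le_add_self
  have hpoint : ∀ x, ‖H x‖ₑ * ENNReal.ofReal (Real.exp (dyadicPotential u N x).re)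
      ≤ 1 + ‖H x‖ₑ ^ 2 + (Ioo 0 1).indicator (fun x => ENNReal.ofReal (Real.exp (-u (dyad 0)))
        * (‖H x‖ₑ ^ 2 * ENNReal.ofReal (Real.exp (u x)))) x := fun x => by
    refine (hle_sq _).trans ?_
    rw [mul_pow, add_assoc]
    gcongr
    refine (mul_le_mul_right (exp_dyadicPotential_re_sq_le hu x N) _).trans_eq ?_
    rw [mul_add, mul_one]
    by_cases hx : x ∈ Ioo (0 : ℝ) 1
    · rw [indicator_of_mem hx, indicator_of_mem hx, mul_left_comm,
        ← ENNReal.ofReal_mul (Real.exp_nonneg _), ← Real.exp_add, neg_add_eq_sub]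
    · rw [indicator_of_notMem hx, indicator_of_notMem hx, mul_zero]
  refine (lintegral_mono hpoint).trans ?_
  have hmeas : AEMeasurable (fun x => 1 + ‖H x‖ₑ ^ 2) κ := (hH.1.enorm.pow_const 2).const_add 1
  rw [lintegral_add_left' hmeas,
    lintegral_add_left measurable_const, lintegral_one, measure_univ,
    lintegral_indicator measurableSet_Ioo, lintegral_const_mul' _ _ ENNReal.ofReal_ne_top]
  gcongr
  exact cauchyMeasure_le_volume

end Antitone

/-! ### The contribution of the nonpositive frequencies -/

/-- The numbers `1/(2πφ_i)` for the positive frequencies `φ_i`, `i ∈ p`: integrating by parts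
against `diffProd (annihilators φ p)` removes these frequencies from an exponential sum. -/
noncomputable def annihilators {ι : Type*} (φ : ι → ℝ) (p : Finset ι) : List ℝ :=
  {i ∈ p | 0 < φ i}.toList.map fun i => (2 * Real.pi * φ i)⁻¹

/-- The value at `-iY` of the exponential sum over `p` once `diffProd (annihilators φ p)` has
removed its positive frequencies, the nonpositive ones being extended to the lower half-plane. -/
noncomputable def survivor {ι : Type*} (φ : ι → ℝ) (a : ι → ℂ) (p : Finset ι) (Y : ℝ) : ℂ :=
  ∑ i ∈ p with φ i ≤ 0,
    a i * (((annihilators φ p).map fun c : ℝ => (1 - 2 * Real.pi * c * φ i : ℂ)).prod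
      * Real.exp (2 * Real.pi * φ i * Y))

/-- A bound for the term of index `i` of `survivor φ a p Y` at a negative frequency, valid for all
`p` when `σ` bounds the sums of the square roots of the annihilators. -/
noncomputable def survivorTail {ι : Type*} (φ : ι → ℝ) (a : ι → ℂ) (σ Y : ℝ)
    (i : ι) : ℝ :=
  if φ i < 0 then ‖a i‖ * Real.exp (σ + 2 * Real.pi * φ i * (Y - σ)) else 0

theorem norm_prod_one_sub_le {μ : ℝ} (hμ : μ ≤ 0) {l : List ℝ} (hl : ∀ c ∈ l, 0 < c) :
    ‖(l.map fun c : ℝ => (1 - 2 * Real.pi * c * μ : ℂ)).prod‖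
      ≤ Real.exp ((1 - 2 * Real.pi * μ) * (l.map Real.sqrt).sum) := by
  have hfactor : ∀ c : ℝ, 0 < c →
      ‖(1 - 2 * Real.pi * c * μ : ℂ)‖ ≤ Real.exp ((1 - 2 * Real.pi * μ) * √c) := fun c hc => by
    have hv : 0 ≤ -(2 * Real.pi * μ) := by nlinarith [Real.pi_pos]
    have hsq : -(2 * Real.pi * c * μ) = (√(-(2 * Real.pi * μ)) * √c) ^ 2 := by
      rw [mul_pow, Real.sq_sqrt hv, Real.sq_sqrt hc.le]
      ring
    have hcast : (1 - 2 * Real.pi * c * μ : ℂ) = ((1 + -(2 * Real.pi * c * μ) : ℝ) : ℂ) := by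
      push_cast
      ring
    rw [hcast, hsq, Complex.norm_of_nonneg (by positivity)]
    set r := √(-(2 * Real.pi * μ))
    have hr : 2 * r ≤ 1 - 2 * Real.pi * μ := by nlinarith [sq_nonneg (r - 1), Real.sq_sqrt hv]
    calc 1 + (r * √c) ^ 2 ≤ 1 + 2 * (r * √c) + (2 * (r * √c)) ^ 2 / 2 := by
          nlinarith [mul_nonneg (Real.sqrt_nonneg (-(2 * Real.pi * μ))) (Real.sqrt_nonneg c)]
      _ ≤ Real.exp (2 * r * √c) := by
          rw [mul_assoc]
          exact Real.quadratic_le_exp_of_nonneg (by positivity)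
      _ ≤ Real.exp ((1 - 2 * Real.pi * μ) * √c) := by gcongr
  induction l with
  | nil => simp
  | cons c l ih =>
    rw [List.forall_mem_cons] at hl
    rw [List.map_cons, List.prod_cons, norm_mul, List.map_cons, List.sum_cons, mul_add,
      Real.exp_add]
    exact mul_le_mul (hfactor c hl.1) (ih hl.2) (norm_nonneg _) (Real.exp_nonneg _)

section Survivor

variable {ι : Type*} {φ : ι → ℝ} {a : ι → ℂ} {p : Finset ι}

theorem annihilators_pos : ∀ c ∈ annihilators φ p, 0 < c := by
  refine List.forall_mem_map.2 fun i hi => ?_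
  have hφ : 0 < φ i := (Finset.mem_filter.1 (Finset.mem_toList.1 hi)).2
  positivity

theorem exists_sum_sqrt_annihilators_le (h : Summable fun i => 1 / √(φ i)) :
    ∃ σ, ∀ p, ((annihilators φ p).map Real.sqrt).sum ≤ σ := by
  have hsqrt : ∀ i, √(2 * Real.pi * φ i)⁻¹ = (√(2 * Real.pi))⁻¹ * (1 / √(φ i)) := fun i => by
    rw [Real.sqrt_inv, Real.sqrt_mul (by positivity), mul_inv, one_div]
  refine ⟨∑' i, √(2 * Real.pi * φ i)⁻¹, fun p => ?_⟩
  rw [annihilators, List.map_map, Finset.sum_map_toList]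
  exact ((h.mul_left _).congr fun i => (hsqrt i).symm).sum_le_tsum _ fun i _ => Real.sqrt_nonneg _

theorem prod_annihilators_eq_zero {i : ι} (hi : i ∈ p) (hφ : 0 < φ i) :
    ((annihilators φ p).map fun c : ℝ => (1 - 2 * Real.pi * c * φ i : ℂ)).prod = 0 := by
  have hmem : (2 * Real.pi * φ i)⁻¹ ∈ annihilators φ p :=
    List.mem_map_of_mem (Finset.mem_toList.2 (Finset.mem_filter.2 ⟨hi, hφ⟩))
  refine List.prod_eq_zero (List.mem_map.2 ⟨_, hmem, ?_⟩)
  have hne : (2 * Real.pi * φ i : ℂ) ≠ 0 := by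
    exact_mod_cast (mul_pos Real.two_pi_pos hφ).ne'
  rw [mul_right_comm, Complex.ofReal_inv]
  push_cast
  rw [mul_inv_cancel₀ hne, sub_self]

theorem integral_expoSum_mul_diffProd {h : ℂ → ℂ} (hh : BddHalfPlane h) {Y : ℝ} (hY : 0 < Y) :
    ∫ x : ℝ, expoSum φ a p x
        * diffProd (annihilators φ p) (fun z => h z / (z ^ 2 + (Y : ℂ) ^ 2)) x
      = Real.pi / Y * h (-(Y * Complex.I)) * survivor φ a p Y := by
  have hdecay := hh.stripDecay hY
  have hint := (hdecay.diffProd (annihilators φ p)).integrable_ofReal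
  simp only [expoSum, Finset.sum_mul, mul_assoc]
  rw [integral_finsetSum _ fun i _ => (integrable_expo_mul hint (φ i)).const_mul (a i)]
  simp only [integral_const_mul, integral_expo_mul_diffProd hdecay]
  rw [survivor, Finset.mul_sum, Finset.mul_sum, Finset.sum_filter]
  refine Finset.sum_congr rfl fun i hi => ?_
  split_ifs with hφ
  · rw [hh.integral_expo_mul_div hY hφ]
    ring
  · rw [prod_annihilators_eq_zero hi (not_le.1 hφ), zero_mul, mul_zero]

theorem survivorTail_nonneg (σ Y : ℝ) (i : ι) : 0 ≤ survivorTail φ a σ Y i := by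
  unfold survivorTail
  split_ifs <;> positivity

theorem survivorTail_le {σ Y : ℝ} (hY : σ + 1 ≤ Y) (i : ι) :
    survivorTail φ a σ Y i ≤ Real.exp σ * (‖a i‖ * Real.exp (-|φ i|)) := by
  unfold survivorTail
  split_ifs with hi
  · rw [mul_left_comm, ← Real.exp_add, abs_of_neg hi, neg_neg]
    gcongr
    nlinarith [mul_nonneg (neg_nonneg.2 hi.le) (sub_nonneg.2 hY), Real.two_le_pi]
  · positivity

theorem summable_survivorTail (habs : Summable fun i => ‖a i‖ * Real.exp (-|φ i|)) {σ Y : ℝ}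
    (hY : σ + 1 ≤ Y) : Summable (survivorTail φ a σ Y) :=
  .of_nonneg_of_le (survivorTail_nonneg σ Y) (survivorTail_le hY) (habs.mul_left _)

theorem tendsto_tsum_survivorTail (habs : Summable fun i => ‖a i‖ * Real.exp (-|φ i|)) (σ : ℝ) :
    Tendsto (fun Y => ∑' i, survivorTail φ a σ Y i) atTop (𝓝 0) := by
  rw [← tsum_zero (β := ι)]
  refine tendsto_tsum_of_dominated_convergence (habs.mul_left (Real.exp σ)) (fun i => ?_) ?_
  · unfold survivorTail
    split_ifs with hi
    · have hexponent : Tendsto (fun Y => σ + 2 * Real.pi * φ i * (Y - σ)) atTop atBot :=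
        tendsto_atBot_add_const_left _ _ <|
          (tendsto_atTop_add_const_right _ (-σ) tendsto_id).const_mul_atTop_of_neg
            (mul_neg_of_pos_of_neg (by positivity) hi)
      simpa using (Real.tendsto_exp_atBot.comp hexponent).const_mul ‖a i‖
    · exact tendsto_const_nhds
  · filter_upwards [eventually_ge_atTop (σ + 1)] with Y hY i
    rw [Real.norm_of_nonneg (survivorTail_nonneg σ Y i)]
    exact survivorTail_le hY i

theorem norm_survivor_sub_le {i₀ : ι} (h0 : φ i₀ = 0) (hinj : ∀ i, φ i = 0 → i = i₀) {σ Y : ℝ}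
    (hσ : ((annihilators φ p).map Real.sqrt).sum ≤ σ) (hs : Summable (survivorTail φ a σ Y))
    (hp : i₀ ∈ p) : ‖survivor φ a p Y - a i₀‖ ≤ ∑' i, survivorTail φ a σ Y i := by
  classical
  have hmem : i₀ ∈ {i ∈ p | φ i ≤ 0} := Finset.mem_filter.2 ⟨hp, h0.le⟩
  rw [survivor, ← Finset.add_sum_erase _ _ hmem]
  simp only [h0, Complex.ofReal_zero, mul_zero, sub_zero, zero_mul, Real.exp_zero,
    Complex.ofReal_one, mul_one, List.map_const', List.prod_replicate, one_pow,
    add_sub_cancel_left]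
  refine (norm_sum_le_of_le _ fun i hi => ?_).trans
    (hs.sum_le_tsum _ fun i _ => survivorTail_nonneg σ Y i)
  rw [Finset.mem_erase, Finset.mem_filter] at hi
  have hneg : φ i < 0 := hi.2.2.lt_of_ne fun h => hi.1 (hinj i h)
  have hprod := norm_prod_one_sub_le hneg.le (annihilators_pos (φ := φ) (p := p))
  rw [survivorTail, if_pos hneg, norm_mul, norm_mul,
    Complex.norm_of_nonneg (Real.exp_nonneg _)]
  gcongr
  refine (mul_le_mul_of_nonneg_right hprod (Real.exp_nonneg _)).trans ?_
  rw [← Real.exp_add, Real.exp_le_exp]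
  have hcoef : 0 ≤ 1 - 2 * Real.pi * φ i := by nlinarith [Real.pi_pos]
  linarith [mul_le_mul_of_nonneg_left hσ hcoef]

theorem eventually_half_norm_le_norm_survivor {i₀ : ι} (h0 : φ i₀ = 0)
    (hinj : ∀ i, φ i = 0 → i = i₀) (ha : a i₀ ≠ 0)
    (habs : Summable fun i => ‖a i‖ * Real.exp (-|φ i|)) {σ : ℝ}
    (hσ : ∀ p, ((annihilators φ p).map Real.sqrt).sum ≤ σ) :
    ∀ᶠ Y in atTop, ∀ p, i₀ ∈ p → ‖a i₀‖ / 2 ≤ ‖survivor φ a p Y‖ := by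
  have hhalf : 0 < ‖a i₀‖ / 2 := half_pos (norm_pos_iff.2 ha)
  filter_upwards [eventually_ge_atTop (σ + 1),
    (tendsto_tsum_survivorTail habs σ).eventually_lt_const hhalf] with Y hY hsmall p hp
  have hsub := norm_survivor_sub_le h0 hinj (hσ p) (summable_survivorTail habs hY) hp
  rw [norm_sub_rev] at hsub
  linarith [norm_sub_norm_le (a i₀) (survivor φ a p Y)]

end Survivor

theorem lintegral_div_sq_add_sq_le (F : ℝ → ℝ≥0∞) {Y : ℝ} (hY : 1 ≤ Y) :
    ∫⁻ x, F x * ENNReal.ofReal (1 / (x ^ 2 + Y ^ 2)) ≤ ENNReal.ofReal Real.pi * ∫⁻ x, F x ∂κ := by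
  rw [cauchyMeasure_zero_one, lintegral_withDensity_eq_lintegral_mul_non_measurable _
    (by fun_prop) (Eventually.of_forall fun _ => ENNReal.ofReal_lt_top),
    ← lintegral_const_mul' _ _ ENNReal.ofReal_ne_top]
  refine lintegral_mono fun x => ?_
  rw [Pi.mul_apply, ← mul_assoc, ← ENNReal.ofReal_mul Real.pi_pos.le,
    mul_inv_cancel_left₀ Real.pi_ne_zero, mul_comm]
  gcongr
  exact one_le_pow₀ hY

section LowerBound

variable {ι α : Type*} {φ : ι → ℝ} {a : ι → ℂ} {p : Finset ι} {S : Finset α} {c s : α → ℝ}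
  {A Y : ℝ}

theorem enorm_integral_expoSum_mul_diffProd_le (hc : ∀ n ∈ S, 0 ≤ c n) (hs : ∀ n ∈ S, 0 < s n)
    (hY : 1 ≤ Y) (hA : 0 < A) (hcA : 60 * ∑ n ∈ S, c n * s n ≤ A)
    (hlA : 20 * ((annihilators φ p).map Real.sqrt).sum ≤ √A) :
    ‖∫ x : ℝ, expoSum φ a p x * diffProd (annihilators φ p)
        (fun z => dampedOuter S c s A (annihilators φ p) z / (z ^ 2 + (Y : ℂ) ^ 2)) x‖ₑ
      ≤ ENNReal.ofReal Real.pi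
        * (4 * ∫⁻ x, ‖expoSum φ a p x‖ₑ * ENNReal.ofReal (Real.exp (potential S c s x).re) ∂κ) := by
  rw [← lintegral_const_mul' _ _ ENNReal.ofNat_ne_top]
  refine (enorm_integral_le_lintegral_enorm _).trans
    ((lintegral_mono_ae ?_).trans (lintegral_div_sq_add_sq_le _ hY))
  filter_upwards [Measure.ae_ne volume 0] with x hx
  have hbound := norm_diffProd_dampedOuter_div_le hc hs hA annihilators_pos hcA hlA Y hx
  rw [enorm_mul, mul_left_comm, mul_assoc]
  gcongr
  rw [← ofReal_norm]
  refine (ENNReal.ofReal_le_ofReal hbound).trans_eq ?_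
  rw [ENNReal.ofReal_mul (by norm_num), div_eq_mul_one_div, ENNReal.ofReal_mul (by positivity),
    mul_assoc, ENNReal.ofReal_ofNat]

theorem ofReal_exp_div_mul_norm_survivor_le {σ : ℝ} (hc : ∀ n ∈ S, 0 ≤ c n)
    (hs : ∀ n ∈ S, 0 < s n) (hsY : ∀ n ∈ S, s n ≤ Y) (hY : 1 ≤ Y) (hA : 0 < A)
    (hcA : 60 * ∑ n ∈ S, c n * s n ≤ A) (hσ : ((annihilators φ p).map Real.sqrt).sum ≤ σ)
    (hσA : 20 * σ ≤ √A) :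
    ENNReal.ofReal (Real.exp ((∑ n ∈ S, c n * s n) / (4 * Y) - 10 * (√A * σ / Y)) / Y
        * ‖survivor φ a p Y‖)
      ≤ 4 * ∫⁻ x, ‖expoSum φ a p x‖ₑ * ENNReal.ofReal (Real.exp (potential S c s x).re) ∂κ := by
  have hY0 : 0 < Y := one_pos.trans_le hY
  set l := annihilators φ p
  set E := Real.exp ((∑ n ∈ S, c n * s n) / (4 * Y) - 10 * (√A * σ / Y)) with hE
  have hlower : E ≤ ‖dampedOuter S c s A l (-(Y * Complex.I))‖ :=
    le_trans (by rw [hE]; gcongr) (exp_le_norm_dampedOuter_neg_mul_I hc hs hA.le hY0 hsY)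
  have hvalue := integral_expoSum_mul_diffProd (φ := φ) (a := a) (p := p)
    (bddHalfPlane_dampedOuter (c := c) hs hA (annihilators_pos (φ := φ) (p := p))) hY0
  have hupper := enorm_integral_expoSum_mul_diffProd_le (φ := φ) (a := a) (p := p) hc hs hY hA hcA
    ((mul_le_mul_of_nonneg_left hσ (by norm_num)).trans hσA)
  rw [← ENNReal.mul_le_mul_iff_right (ENNReal.ofReal_pos.2 Real.pi_pos).ne' ENNReal.ofReal_ne_top]
  refine le_trans ?_ hupper
  rw [← ENNReal.ofReal_mul Real.pi_pos.le, hvalue, ← ofReal_norm, norm_mul, norm_mul, norm_div,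
    Complex.norm_of_nonneg Real.pi_pos.le, Complex.norm_of_nonneg hY0.le]
  refine ENNReal.ofReal_le_ofReal ?_
  calc Real.pi * (E / Y * ‖survivor φ a p Y‖) = Real.pi / Y * E * ‖survivor φ a p Y‖ := by ring
    _ ≤ _ := by gcongr

end LowerBound

theorem HasExpoSum.le_lintegral_of_eventually_le {ι : Type*} {φ : ι → ℝ} {a : ι → ℂ} {H : ℝ → ℂ}
    (hH : HasExpoSum φ a H) {g : ℝ → ℝ} {B : ℝ} (hg : ∀ x, g x ≤ B) {m : ℝ≥0∞}
    (hm : ∀ᶠ p in atTop, m ≤ ∫⁻ x, ‖expoSum φ a p x‖ₑ * ENNReal.ofReal (Real.exp (g x)) ∂κ) :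
    m ≤ ∫⁻ x, ‖H x‖ₑ * ENNReal.ofReal (Real.exp (g x)) ∂κ := by
  have hdiff : ∀ p, AEStronglyMeasurable (fun x => H x - expoSum φ a p x) κ := fun p =>
    hH.memLp.1.sub (continuous_expoSum p).aestronglyMeasurable
  have herror := (ENNReal.Tendsto.const_mul (a := ENNReal.ofReal (Real.exp B)) hH.tendsto
    (Or.inr ENNReal.ofReal_ne_top)).const_add
      (∫⁻ x, ‖H x‖ₑ * ENNReal.ofReal (Real.exp (g x)) ∂κ)
  rw [mul_zero, add_zero] at herror
  refine ge_of_tendsto herror (hm.mono fun p hp => hp.trans ?_)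
  have hpoint : ∀ x, ‖expoSum φ a p x‖ₑ * ENNReal.ofReal (Real.exp (g x))
      ≤ ‖H x‖ₑ * ENNReal.ofReal (Real.exp (g x))
        + ENNReal.ofReal (Real.exp B) * ‖H x - expoSum φ a p x‖ₑ := fun x => by
    have htriangle := enorm_sub_le (a := H x) (b := H x - expoSum φ a p x)
    rw [sub_sub_cancel] at htriangle
    refine (mul_le_mul_left htriangle _).trans ?_
    rw [add_mul, mul_comm ‖H x - _‖ₑ]
    gcongr
    exact hg x
  calc _ ≤ _ := lintegral_mono hpoint
    _ = (∫⁻ x, ‖H x‖ₑ * ENNReal.ofReal (Real.exp (g x)) ∂κ)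
        + ENNReal.ofReal (Real.exp B) * eLpNorm (fun x => H x - expoSum φ a p x) 1 κ := by
      rw [lintegral_add_right' _ ((hdiff p).enorm.const_mul _),
        lintegral_const_mul' _ _ ENNReal.ofReal_ne_top, eLpNorm_one_eq_lintegral_enorm]
    _ ≤ _ := by
      gcongr
      exact eLpNorm_le_eLpNorm_of_exponent_le (by norm_num) (hdiff p)

/-! ### Vanishing of the coefficients -/

theorem tendsto_exp_div_sub_sqrt_atTop (C : ℝ) {Y m : ℝ} (hY : 0 < Y) (hm : 0 < m) :
    Tendsto (fun A => Real.exp (A / 60 / (4 * Y) - 10 * (√A * C / Y)) / Y * m) atTop atTop := by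
  have hexponent : ∀ A, 0 ≤ A →
      √A * ((√A / 240 - 10 * C) / Y) = A / 60 / (4 * Y) - 10 * (√A * C / Y) := fun A hA => by
    linear_combination Real.mul_self_sqrt hA / (240 * Y)
  have hfactor : Tendsto (fun A => (√A / 240 - 10 * C) / Y) atTop atTop :=
    (tendsto_atTop_add_const_right _ _
      (Real.tendsto_sqrt_atTop.atTop_div_const (by norm_num))).atTop_div_const hY
  exact ((Real.tendsto_exp_atTop.comp ((Real.tendsto_sqrt_atTop.atTop_mul_atTop₀ hfactor).congr'
    ((eventually_ge_atTop 0).mono hexponent))).atTop_div_const hY).atTop_mul_const hm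

section Vanishing

variable {ι : Type*} {φ : ι → ℝ} {a : ι → ℂ} {H : ℝ → ℂ} {u : ℝ → ℝ}

theorem HasExpoSum.ofReal_exp_div_mul_le (hH : HasExpoSum φ a H) (hu : AntitoneOn u (Ioo 0 1))
    {N : ℕ} {A σ Y m : ℝ} (hY : 1 ≤ Y) (hA : 0 < A)
    (hNA : 60 * (3 / 128 * ∑ n ∈ Finset.range N, dyadicStep u n * dyad n) = A)
    (hσ : ∀ p, ((annihilators φ p).map Real.sqrt).sum ≤ σ) (hσA : 20 * σ ≤ √A)
    (hm : ∀ᶠ p in atTop, m ≤ ‖survivor φ a p Y‖) :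
    ENNReal.ofReal (Real.exp (A / 60 / (4 * Y) - 10 * (√A * σ / Y)) / Y * m)
      ≤ 4 * (1 + ∫⁻ x, ‖H x‖ₑ ^ 2 ∂κ + ENNReal.ofReal (Real.exp (-u (dyad 0)))
          * ∫⁻ x in Ioo (0 : ℝ) 1, ‖H x‖ₑ ^ 2 * ENNReal.ofReal (Real.exp (u x))) := by
  have hc : ∀ n ∈ Finset.range N, 0 ≤ 3 / 16 * dyadicStep u n := fun n _ =>
    mul_nonneg (by norm_num) (dyadicStep_nonneg hu n)
  have hs : ∀ n ∈ Finset.range N, 0 < dyad (n + 1) / 4 := fun n _ =>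
    div_pos (dyad_pos _) (by norm_num)
  have hsY : ∀ n ∈ Finset.range N, dyad (n + 1) / 4 ≤ Y := fun n _ => by
    linarith [dyad_lt_one (n + 1)]
  rw [← sum_dyadicPotential_coeff_mul_scale] at hNA
  have hpartial : ∀ᶠ p in atTop,
      ENNReal.ofReal (Real.exp (A / 60 / (4 * Y) - 10 * (√A * σ / Y)) / Y * m) / 4
        ≤ ∫⁻ x, ‖expoSum φ a p x‖ₑ * ENNReal.ofReal (Real.exp (dyadicPotential u N x).re) ∂κ :=
    hm.mono fun p hp => by
      have hsurvivor := ofReal_exp_div_mul_norm_survivor_le (a := a) hc hs hsY hY hA hNA.le (hσ p)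
        hσA
      rw [← hNA, mul_div_cancel_left₀ _ (by norm_num), hNA]
      refine ENNReal.div_le_of_le_mul' (le_trans ?_ hsurvivor)
      gcongr
  exact (ENNReal.div_le_iff' (by norm_num) (by norm_num)).1 <|
    (hH.le_lintegral_of_eventually_le (potential_re_ofReal_le hc _) hpartial).trans
      (lintegral_enorm_mul_exp_dyadicPotential_le hu hH.memLp N)

theorem HasExpoSum.coeff_eq_zero_of_freq_eq_zero (hH : HasExpoSum φ a H)
    (hu : AntitoneOn u (Ioo 0 1)) (hinf : ∫⁻ x in Ioo (0 : ℝ) 1, ENNReal.ofReal (u x) = ∞)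
    (hHu : ∫⁻ x in Ioo (0 : ℝ) 1, ‖H x‖ₑ ^ 2 * ENNReal.ofReal (Real.exp (u x)) < ∞)
    (hsqrt : Summable fun i => 1 / √(φ i)) (habs : Summable fun i => ‖a i‖ * Real.exp (-|φ i|))
    {i₀ : ι} (h0 : φ i₀ = 0) (hinj : ∀ i, φ i = 0 → i = i₀) : a i₀ = 0 := by
  by_contra ha
  obtain ⟨σ, hσ⟩ := exists_sum_sqrt_annihilators_le hsqrt
  obtain ⟨Y, hsurvivor, hY⟩ := ((eventually_half_norm_le_norm_survivor h0 hinj ha habs hσ).and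
    (eventually_ge_atTop 1)).exists
  set K := 4 * (1 + ∫⁻ x, ‖H x‖ₑ ^ 2 ∂κ + ENNReal.ofReal (Real.exp (-u (dyad 0)))
    * ∫⁻ x in Ioo (0 : ℝ) 1, ‖H x‖ₑ ^ 2 * ENNReal.ofReal (Real.exp (u x)))
  have hK : K ≠ ∞ := by
    have hL2 : ∫⁻ x, ‖H x‖ₑ ^ 2 ∂κ ≠ ∞ := by
      simpa using (lintegral_rpow_enorm_lt_top_of_eLpNorm_lt_top two_ne_zero
        ENNReal.ofNat_ne_top hH.memLp.2).ne
    finiteness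
  have hlarge := (tendsto_exp_div_sub_sqrt_atTop σ (one_pos.trans_le hY)
    (half_pos (norm_pos_iff.2 ha))).eventually_gt_atTop K.toReal
  obtain ⟨A₀, hA₀⟩ := eventually_atTop.1 ((hlarge.and (eventually_gt_atTop 0)).and
    (Real.tendsto_sqrt_atTop.eventually_ge_atTop (20 * σ)))
  obtain ⟨N, hN⟩ := exists_le_sum_dyadicStep_mul_dyad hu hinf (32 / 45 * A₀)
  obtain ⟨⟨hgt, hA⟩, hσA⟩ :=
    hA₀ (60 * (3 / 128 * ∑ n ∈ Finset.range N, dyadicStep u n * dyad n)) (by linarith)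
  refine hgt.not_ge ((ENNReal.ofReal_le_iff_le_toReal hK).1
    (hH.ofReal_exp_div_mul_le hu hY hA rfl hσ hσA ?_))
  filter_upwards [eventually_ge_atTop {i₀}] with p hp
  exact hsurvivor p (hp (Finset.mem_singleton_self i₀))

theorem HasExpoSum.coeff_eq_zero (hH : HasExpoSum φ a H) (hu : AntitoneOn u (Ioo 0 1))
    (hinf : ∫⁻ x in Ioo (0 : ℝ) 1, ENNReal.ofReal (u x) = ∞)
    (hHu : ∫⁻ x in Ioo (0 : ℝ) 1, ‖H x‖ₑ ^ 2 * ENNReal.ofReal (Real.exp (u x)) < ∞)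
    (hφ : Function.Injective φ) (hsqrt : ∀ ν, Summable fun i => 1 / √(φ i - ν))
    (habs : ∀ ν, Summable fun i => ‖a i‖ * Real.exp (-|φ i - ν|)) (i : ι) : a i = 0 := by
  refine (hH.translate (φ i)).coeff_eq_zero_of_freq_eq_zero hu hinf ?_ (hsqrt _) (habs _)
    (sub_self _) fun j hj => hφ (sub_eq_zero.1 hj)
  have hnorm : ∀ x, ‖H x * expo (-φ i) x‖ₑ = ‖H x‖ₑ := fun x => by
    rw [← ofReal_norm, norm_mul, norm_expo, mul_one, ofReal_norm]
  simpa only [hnorm] using hHu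

end Vanishing

section Freq

variable {L G : Set ℝ}

theorem freq_injective (hLG : Disjoint L G) : Function.Injective (freq L G) :=
  Subtype.val_injective.sumElim Subtype.val_injective fun l g h =>
    disjoint_left.1 hLG l.2 (h ▸ g.2)

theorem summable_one_div_sqrt_freq_sub (hL : BddAbove L) (hG : G ⊆ Ioi 0)
    (hLud : UniformlyDiscrete L) (hsum : Summable fun g : G => 1 / √(g : ℝ)) (ν : ℝ) :
    Summable fun i => 1 / √(freq L G i - ν) :=
  .sum _ (hLud.summable_one_div_sqrt_sub_of_bddAbove hL ν)
    (summable_one_div_sqrt_sub (fun g => hG g.2) hsum ν)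

theorem exists_hasExpoSum_freq (hLud : UniformlyDiscrete L) (hGud : UniformlyDiscrete G)
    {a : L → ℂ} {b : G → ℂ} (ha : Memℓp a 2) (hb : Memℓp b 2) :
    ∃ H, StronglyMeasurable H ∧ HasExpoSum (freq L G) (Sum.elim a b) H :=
  exists_hasExpoSum (.sum _ (hLud.summable_smul_expoLp ha) (hGud.summable_smul_expoLp hb))

end Freq

theorem isNonharmonicSeries_zero {L G : Set ℝ} {a : L → ℂ} {b : G → ℂ} (ha : ∀ l, a l = 0)
    (hb : ∀ g, b g = 0) : IsNonharmonicSeries a b 0 :=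
  ⟨aestronglyMeasurable_zero, fun R => by simp [partialSum, ha, hb]⟩

theorem MemWeightedL2.lintegral_enorm_sq_mul_exp_lt_top {w : ℝ → ℝ} {H : ℝ → ℂ}
    (h : MemWeightedL2 w H) (hw : ∀ t ∈ Ioo (0 : ℝ) 1, 0 < w t) :
    ∫⁻ t in Ioo (0 : ℝ) 1, ‖H t‖ₑ ^ 2 * ENNReal.ofReal (Real.exp (-Real.log (w t))) < ∞ := by
  refine (setLIntegral_congr_fun measurableSet_Ioo fun t ht => ?_).trans_lt h
  rw [Real.exp_neg, Real.exp_log (hw t ht), ← ofReal_norm, ← ENNReal.ofReal_pow (norm_nonneg _),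
    ← ENNReal.ofReal_mul (by positivity), div_eq_mul_inv]

theorem theorem3_general {L G : Set ℝ} (hL : BddAbove L) (hG : G ⊆ Ioi 0) (hLG : Disjoint L G)
    (hLud : UniformlyDiscrete L) (hGud : UniformlyDiscrete G)
    (hsum : Summable fun g : G => 1 / √(g : ℝ)) {a : L → ℂ} {b : G → ℂ} (ha : Memℓp a 2)
    (hb : Memℓp b 2) :
    (∃ H : ℝ → ℂ, IsNonharmonicSeries a b H) ∧
    ∀ H : ℝ → ℂ, IsNonharmonicSeries a b H → ∀ w : ℝ → ℝ, (∀ t ∈ Ioo (0 : ℝ) 1, 0 < w t) →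
      MonotoneOn w (Ioo 0 1) → ∫⁻ t in Ioo (0 : ℝ) 1, ENNReal.ofReal (-Real.log (w t)) = ∞ →
      MemWeightedL2 w H → H =ᵐ[volume] 0 ∧ (∀ l, a l = 0) ∧ (∀ g, b g = 0) := by
  obtain ⟨F, hFmeas, hF⟩ := exists_hasExpoSum_freq hLud hGud ha hb
  have hFseries := hF.isNonharmonicSeries hFmeas.aestronglyMeasurable
  refine ⟨⟨F, hFseries⟩, fun H hH w hpos hmono hinf hHw => ?_⟩
  have hanti : AntitoneOn (fun t => -Real.log (w t)) (Ioo 0 1) := fun s hs t ht hst =>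
    neg_le_neg (Real.log_le_log (hpos s hs) (hmono hs ht hst))
  have hFw : MemWeightedL2 w F := by
    refine (lintegral_congr_ae (ae_restrict_of_ae ?_)).trans_lt hHw
    filter_upwards [hFseries.ae_eq hH] with t ht
    rw [ht]
  have hcoeff := hF.coeff_eq_zero hanti hinf (hFw.lintegral_enorm_sq_mul_exp_lt_top hpos)
    (freq_injective hLG) (summable_one_div_sqrt_freq_sub hL hG hLud hsum) fun ν =>
      .sum _ (hLud.summable_norm_mul_exp_neg_abs_sub ha ν)
        (hGud.summable_norm_mul_exp_neg_abs_sub hb ν)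
  have ha0 : ∀ l, a l = 0 := fun l => hcoeff (Sum.inl l)
  have hb0 : ∀ g, b g = 0 := fun g => hcoeff (Sum.inr g)
  exact ⟨hH.ae_eq (isNonharmonicSeries_zero ha0 hb0), ha0, hb0⟩

theorem theorem3 (L G : Set ℝ) (hL : L ⊆ Iic 0) (hG : G ⊆ Ioi 0)
    (hLud : UniformlyDiscrete L) (hGud : UniformlyDiscrete G)
    (hsum : Summable fun g : G => 1 / Real.sqrt (g : ℝ))
    (a : L → ℂ) (b : G → ℂ) (ha : Memℓp a 2) (hb : Memℓp b 2) :
    (∃ H : ℝ → ℂ, IsNonharmonicSeries a b H) ∧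
    ∀ H : ℝ → ℂ, IsNonharmonicSeries a b H →
      ∀ w : ℝ → ℝ, DeepZeroWeight w → MemWeightedL2 w H →
        H =ᵐ[volume] 0 ∧ (∀ l, a l = 0) ∧ (∀ g, b g = 0) :=
  have hgeneral := theorem3_general (bddAbove_Iic.mono hL) hG
    ((Iic_disjoint_Ioi le_rfl).mono hL hG) hLud hGud hsum ha hb
  ⟨hgeneral.1, fun H hH w hw => hgeneral.2 H hH w hw.pos hw.mono hw.log_integral⟩
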